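/- **Setting.** Let $d\ge 1$, $p\in(1,\infty)$ and $p^{-1}+q^{-1}=1$. Let $\Omega\subset\mathbb R^d$ be non-empty, open, bounded and convex, and let $\Lambda\subset\mathbb R^d$ be convex with $B(0,1/r^*)\subset\Lambda\subset B(0,r^*/2)$ for some $r^*>1$. The space $\mathbb R^{d\times d}$ carries the Frobenius inner product and norm; $\operatorname{div}$ of a matrix field is taken row by row, $(\operatorname{div}\varphi)_i=\sum_j\partial_j\varphi_{ij}$; $\mathcal L^d$ is Lebesgue measure. $W^{1,q}_0(\Omega,\mathbb R^{d\times d})$ is the closure of $C_c^\infty(\Omega,\mathbb R^{d\times d})$ in $W^{1,q}(\Omega,\mathbb R^{d\times d})$. A measurable map $G:\Omega\to\mathbb R^d$ is *non-degenerate* if $\mathcal L^d(G^{-1}(N))=0$ whenever $\mathcal L^d(N)=0$. For $\mathcal S\subset W_0^{1,q}(\Omega,\mathbb R^{d\times d})$, a map $F:\Omega\to\mathbb R^d$ satisfies $(\mathbf{ND})_{\mathcal S}$ if $F+\operatorname{div}\varphi$ is non-degenerate for every $\varphi\in\mathcal S$. For $f:\mathbb R^{d\times d}\to\mathbb R$ let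 $f^*(\xi^*)=\sup_\xi\{\xi\cdot\xi^*-f(\xi)\}\in(-\infty,\infty]$, let $\operatorname{Dom}f^*=\{f^*<\infty\}$, and let $\operatorname{grad}[f^*](\xi^*)$ be the element of minimal norm of the subdifferential $\partial f^*(\xi^*)$ when this is non-empty. **Assumptions.** * $\mathcal S$ is a finite-dimensional linear subspace of $W_0^{1,q}(\Omega,\mathbb R^{d\times d})$, and for every $\varphi\in\mathcal S$ the map $\nabla\varphi$ has countable range (that is, some representative of it takes only countably many values). * $f:\mathbb R^{d\times d}\to\mathbb R$ is convex, and: (i) there are $a,b,c>0$ with $a|\xi|-b\le f(\xi)\le c\,|\xi|^p/p+b$ for all $\xi$, and $|\xi^*|^q\le c|\xi|^p+b$ for all $\xi$ and all $\xi^*\in\partial f(\xi)$; (ii) $\int_\Omega f^*(\varphi)\,dx$ is finite for some $\varphi\in\mathcal S$; (iii) either $f$ is strictly convex, or $\partial f^*(\xi^*)\neq\emptyset$ and $\operatorname{grad}[f^*](\xi^*)=0$ for every $\xi^*\in\operatorname{Dom}f^*$. * $H:(0,\infty)\to\mathbb R$ is $C^1$ and strictly convex, with $\lim_{t\to0^+}H(t)=\lim_{t\to\infty}H(t)/t=+\infty$;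 put $H(0)=+\infty$. * $F:\Omega\to\mathbb R^d$ is measurable, belongs to $L^1(\Omega)$, and is non-degenerate. **The compressible problem.** Let $\mathscr U_{\mathcal S}$ be the set of measurable $u:\Omega\to\bar\Lambda$ for which there is $\bar c>0$ with $\left|\int_\Omega u\cdot\operatorname{div}\varphi\,dx\right|\le\bar c\,\|\varphi\|_{L^q(\Omega,\mathbb R^{d\times d})}$ for all $\varphi\in\mathcal S$. Let $\mathscr U^*_{\mathcal S}$ be the set of pairs $(u,\beta)$ with $u\in\mathscr U_{\mathcal S}$ and $\beta:\Omega\to[0,\infty)$ measurable such that, for all $l\in C_c(\mathbb R^d)$, the function $l(u)\beta$ is integrable on $\Omega$ and $$\int_\Omega l(u(x))\,\beta(x)\,dx=\int_\Lambda l(y)\,dy .$$ With $$V^f_{\mathcal S}(u)=\sup_{\varphi\in\mathcal S}\int_\Omega\bigl(-u\cdot\operatorname{div}\varphi-f^*(\varphi)\bigr)\,dx,$$ the problem is $$\inf_{(u,\beta)\in\mathscr U_{\mathcal S}^*}\Bigl\{I(u,\beta)=V^f_{\mathcal S}(u)+\int_\Omega\bigl(H(\beta)-F\cdot u\bigr)\,dx\Bigr\}.\tag{P}$$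 Here integrals of functions with values in $(-\infty,\infty]$ or $[-\infty,\infty)$ are extended-real-valued. **Statement.** Under these assumptions, $F$ satisfies $(\mathbf{ND})_{\mathcal S}$, and problem (P) has a minimizer $(u,\beta)\in\mathscr U^*_{\mathcal S}$, which is unique up to equality almost everywhere in $\Omega$. -/

import Mathlib

open MeasureTheory Set Filter Topology
open scoped ENNReal ContDiff

namespace PseudoGradient

/-- `ℝ^d` with its Euclidean norm. -/
abbrev Vec (d : ℕ) : Type := EuclideanSpace ℝ (Fin d)

/-- `ℝ^{d×d}` with the Frobenius inner product and norm; the entry `(i, j)` of `ξ` is `ξ (i, j)`. -/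
abbrev Mat (d : ℕ) : Type := EuclideanSpace ℝ (Fin d × Fin d)

/-! ### Sobolev functions -/

/-- Pairs of a function class in `L^q(Ω; ℝ^{d×d})` and a candidate for its gradient, in `L^q` too.
A Sobolev function `φ` is handled as the pair `(φ, ∇φ)`. -/
abbrev LqPair (d : ℕ) (q : ℝ) (Ω : Set (Vec d)) : Type :=
  Lp (Mat d) (ENNReal.ofReal q) (volume.restrict Ω) ×
    Lp (Vec d →L[ℝ] Mat d) (ENNReal.ofReal q) (volume.restrict Ω)

/-- `η` belongs to `C_c^∞(Ω; V)` (extended by zero). -/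
structure IsTestFunction {d : ℕ} {V : Type*} [NormedAddCommGroup V] [NormedSpace ℝ V]
    (Ω : Set (Vec d)) (η : Vec d → V) : Prop where
  smooth : ContDiff ℝ ∞ η
  compact_support : HasCompactSupport η
  support_subset : tsupport η ⊆ Ω

/-- `G` is the weak (distributional) gradient of `φ` on `Ω`. -/
structure HasWeakGradient {d : ℕ} (Ω : Set (Vec d)) (φ : Vec d → Mat d)
    (G : Vec d → (Vec d →L[ℝ] Mat d)) : Prop where
  locallyIntegrable : LocallyIntegrableOn φ Ω
  locallyIntegrable_grad : LocallyIntegrableOn G Ω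
  integral_eq : ∀ η : Vec d → ℝ, IsTestFunction Ω η → ∀ v : Vec d,
    ∫ x in Ω, (fderiv ℝ η x v) • φ x = - ∫ x in Ω, η x • G x v

/-- `w = (φ, ∇φ)` with `φ ∈ W_0^{1,q}(Ω; ℝ^{d×d})`: the second component is the weak gradient of the
first, and `φ` is a limit of functions of `C_c^∞(Ω; ℝ^{d×d})` in the norm of `W^{1,q}`. -/
structure MemSobolevZero {d : ℕ} {q : ℝ} {Ω : Set (Vec d)} (w : LqPair d q Ω) : Prop where
  weakGradient : HasWeakGradient Ω w.1 w.2
  approx : ∀ ε : ℝ≥0∞, 0 < ε → ∃ η : Vec d → Mat d, IsTestFunction Ω η ∧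
    eLpNorm (fun x => w.1 x - η x) (ENNReal.ofReal q) (volume.restrict Ω) ≤ ε ∧
    eLpNorm (fun x => w.2 x - fderiv ℝ η x) (ENNReal.ofReal q) (volume.restrict Ω) ≤ ε

/-- The row-wise divergence read off from a derivative `A`: `(div)_i = ∑_j ∂_j φ_{ij}`. -/
noncomputable def divOfGrad {d : ℕ} (A : Vec d →L[ℝ] Mat d) : Vec d :=
  WithLp.toLp 2 fun i => ∑ j, A (EuclideanSpace.single j 1) (i, j)

/-- `div φ` for `w = (φ, ∇φ)`. -/
noncomputable def divergence {d : ℕ} {q : ℝ} {Ω : Set (Vec d)} (w : LqPair d q Ω) :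
    Vec d → Vec d :=
  fun x => divOfGrad (w.2 x)

/-- A function class on `Ω` has countable range: some representative takes countably many values. -/
def HasCountableRangeOn {d : ℕ} {X : Type*} (Ω : Set (Vec d)) (G : Vec d → X) : Prop :=
  ∃ C : Set X, C.Countable ∧ ∀ᵐ x ∂(volume.restrict Ω), G x ∈ C

/-- A (Lebesgue) measurable map `G` on `Ω` is non-degenerate: preimages of null sets are null. -/
def NonDegenerateOn {d : ℕ} (Ω : Set (Vec d)) (G : Vec d → Vec d) : Prop :=
  AEMeasurable G (volume.restrict Ω) ∧
    ∀ N : Set (Vec d), volume N = 0 → volume (Ω ∩ G ⁻¹' N) = 0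

/-- The condition `(ND)_S`. -/
def ConditionND {d : ℕ} {q : ℝ} {Ω : Set (Vec d)} (F : Vec d → Vec d)
    (S : Set (LqPair d q Ω)) : Prop :=
  ∀ w ∈ S, NonDegenerateOn Ω (fun x => divergence w x + F x)

/-! ### Convex analysis and extended integrals -/

/-- The integral of an extended real function, `∫ g⁺ - ∫ g⁻`. -/
noncomputable def eintegral {α : Type*} [MeasurableSpace α] (μ : Measure α) (g : α → EReal) :
    EReal :=
  ((∫⁻ x, (g x).toENNReal ∂μ : ℝ≥0∞) : EReal) - ((∫⁻ x, (-g x).toENNReal ∂μ : ℝ≥0∞) : EReal)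

/-- The Legendre transform `f^*(y) = sup_x (x · y - f x)`, with values in `(-∞, ∞]`. -/
noncomputable def legendre {d : ℕ} (f : Mat d → ℝ) (y : Mat d) : EReal :=
  ⨆ x : Mat d, ((inner ℝ x y - f x : ℝ) : EReal)

/-- The subdifferential of `h` at `x` (used for `h x` finite). -/
def subdifferential {d : ℕ} (h : Mat d → EReal) (x : Mat d) : Set (Mat d) :=
  {y | ∀ z, h x + ((inner ℝ y (z - x) : ℝ) : EReal) ≤ h z}

/-- `g = grad[h](x)`: `g` is the element of minimal norm of the subdifferential of `h` at `x`. -/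
def IsGrad {d : ℕ} (h : Mat d → EReal) (x g : Mat d) : Prop :=
  g ∈ subdifferential h x ∧ ∀ y ∈ subdifferential h x, ‖g‖ ≤ ‖y‖

/-- The set `S_f` of those `φ ∈ S` for which `∫_Ω f^*(φ)` is finite. -/
def finiteLegendre {d : ℕ} {q : ℝ} {Ω : Set (Vec d)} (f : Mat d → ℝ) (S : Set (LqPair d q Ω)) :
    Set (LqPair d q Ω) :=
  {w ∈ S | eintegral (volume.restrict Ω) (fun x => legendre f (w.1 x)) ≠ ⊤ ∧
    eintegral (volume.restrict Ω) (fun x => legendre f (w.1 x)) ≠ ⊥}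

/-- The assumptions on `f`. -/
structure AssumptionA1 {d : ℕ} (p q : ℝ) {Ω : Set (Vec d)} (f : Mat d → ℝ)
    (S : Set (LqPair d q Ω)) : Prop where
  convex : ConvexOn ℝ univ f
  growth : ∃ a b c : ℝ, 0 < a ∧ 0 < b ∧ 0 < c ∧
    (∀ ξ, a * ‖ξ‖ - b ≤ f ξ ∧ f ξ ≤ c * ‖ξ‖ ^ p / p + b) ∧
    (∀ ξ, ∀ η ∈ subdifferential (fun x => (f x : EReal)) ξ, ‖η‖ ^ q ≤ c * ‖ξ‖ ^ p + b)
  nonempty : (finiteLegendre f S).Nonempty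
  strict_or_grad_zero : StrictConvexOn ℝ univ f ∨
    ∀ y, legendre f y < ⊤ →
      (subdifferential (legendre f) y).Nonempty ∧ IsGrad (legendre f) y 0

/-- The assumptions on `H : (0, ∞) → ℝ`; values of `H` elsewhere are irrelevant. -/
structure AssumptionA2 (H : ℝ → ℝ) : Prop where
  contDiff : ContDiffOn ℝ 1 H (Ioi 0)
  strictConvex : StrictConvexOn ℝ (Ioi 0) H
  tendsto_zero : Tendsto H (𝓝[>] 0) atTop
  tendsto_atTop : Tendsto (fun t => H t / t) atTop atTop

/-- `H` extended to `[0, ∞)` by its limit `+∞` at `0`. -/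
noncomputable def extendH (H : ℝ → ℝ) (t : ℝ) : EReal :=
  if 0 < t then (H t : EReal) else ⊤

/-! ### The compressible problem -/

/-- `u ∈ 𝒰_S`. -/
structure MemU {d : ℕ} {q : ℝ} {Ω : Set (Vec d)} (Λ : Set (Vec d)) (S : Set (LqPair d q Ω))
    (u : Vec d → Vec d) : Prop where
  measurable : AEMeasurable u (volume.restrict Ω)
  mapsTo : ∀ x ∈ Ω, u x ∈ closure Λ
  bound : ∃ c : ℝ, 0 < c ∧ ∀ w ∈ S, |∫ x in Ω, inner ℝ (u x) (divergence w x)| ≤ c * ‖w.1‖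

/-- `(u, β) ∈ 𝒰_S^*`. -/
structure MemUStar {d : ℕ} {q : ℝ} {Ω : Set (Vec d)} (Λ : Set (Vec d)) (S : Set (LqPair d q Ω))
    (u : Vec d → Vec d) (β : Vec d → ℝ) : Prop where
  memU : MemU Λ S u
  measurable : AEMeasurable β (volume.restrict Ω)
  nonneg : ∀ x ∈ Ω, 0 ≤ β x
  transport : ∀ l : Vec d → ℝ, Continuous l → HasCompactSupport l →
    IntegrableOn (fun x => l (u x) * β x) Ω ∧ ∫ x in Ω, l (u x) * β x = ∫ y in Λ, l y

/-- `V_S^f(u) = sup_{φ ∈ S} ∫_Ω (- u · div φ - f^*(φ))`. -/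
noncomputable def V {d : ℕ} {q : ℝ} {Ω : Set (Vec d)} (f : Mat d → ℝ) (S : Set (LqPair d q Ω))
    (u : Vec d → Vec d) : EReal :=
  ⨆ w ∈ S, eintegral (volume.restrict Ω)
    (fun x => ((-inner ℝ (u x) (divergence w x) : ℝ) : EReal) - legendre f (w.1 x))

/-- `I(u, β) = V_S^f(u) + ∫_Ω (H(β) - F · u)`. -/
noncomputable def energy {d : ℕ} {q : ℝ} {Ω : Set (Vec d)} (f : Mat d → ℝ) (H : ℝ → ℝ)
    (F : Vec d → Vec d) (S : Set (LqPair d q Ω)) (u : Vec d → Vec d) (β : Vec d → ℝ) : EReal :=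
  V f S u + eintegral (volume.restrict Ω)
    (fun x => extendH H (β x) - ((inner ℝ (F x) (u x) : ℝ) : EReal))

/-- `(u, β)` minimizes `I` over `𝒰_S^*`. -/
def IsMinimizer {d : ℕ} {q : ℝ} {Ω : Set (Vec d)} (Λ : Set (Vec d)) (f : Mat d → ℝ) (H : ℝ → ℝ)
    (F : Vec d → Vec d) (S : Set (LqPair d q Ω)) (u : Vec d → Vec d) (β : Vec d → ℝ) : Prop :=
  MemUStar Λ S u β ∧ ∀ v γ, MemUStar Λ S v γ → energy f H F S u β ≤ energy f H F S v γ

end PseudoGradient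

namespace PseudoGradient

/-! ### The Legendre transform of `H` -/

/-! Non-degeneracy survives because `∇φ`, hence `div φ`, takes only countably many values off a null
set: on each level set `F + div φ` is a translate of `F`, and a countable union of null sets is
null.

The minimizer comes from convex duality. The dual problem minimizes `∫_Ω k(F + div φ) + ∫_Ω f^*(φ) +
∫_Λ ℓ` over `φ ∈ S` and potentials with `y · v - t ℓ(y) - H(t) ≤ k(v)` for all `t > 0`, equivalently
`y · v + A(-ℓ(y)) ≤ k(v)`. Inserting `y = u(x)`, `v = F(x) + div φ(x)`, `t = β(x)`, integrating and
using the transport condition bounds `I(u, β)` below by minus the dual value plus the integral of a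
nonnegative gap (`exists_duality_gap`).

The direct method solves the dual problem (`exists_dual_minimizer`): `S` has finite dimension, `k`
may be required to be Lipschitz since its slopes lie in the bounded set `closure Λ`, and Fatou's
lemma handles `ℓ` and the majorant `h` of `f^*(φ)`. The potentials can then be made conjugate to
each other (`IsFeasible.exists_conjugatePair`). By Rademacher's theorem and non-degeneracy, `k` is
differentiable at `F(x) + div φ(x)` for almost every `x`, so `u = ∇k(F + div φ)` and `β = T(-ℓ(u))`
make sense. Stationarity in `ℓ` is the transport condition (`IsDualMinimizer.integral_eq`);
stationarity in `φ` says that `φ` attains the supremum defining `V(u)`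
(`IsDualMinimizer.variation`). The gap is then zero and `(u, β)` is optimal.

Any other minimizer also has zero gap against the same dual solution. At a point of
differentiability the gradient is the only supporting slope, and strict convexity of `H` makes the
maximizer of `s t - H(t)` unique, so both components are determined almost everywhere. -/

/-- `A` is the Legendre transform of `H`, `T` its derivative (the maximizer), `N` its inverse. -/
structure IsLegendreTriple (H T A N : ℝ → ℝ) : Prop where
  pos : ∀ s, 0 < T s
  cont : Continuous T
  mono : Monotone T
  fenchel : ∀ s t, 0 < t → s * t - H t ≤ A s
  eq : ∀ s, A s = s * T s - H (T s)
  strictMono : StrictMono A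
  cont_inv : Continuous N
  apply_inv : ∀ a, A (N a) = a
  inv_apply : ∀ s, N (A s) = s

theorem AssumptionA2.exists_argmax {H : ℝ → ℝ} (hH : AssumptionA2 H) (s : ℝ) :
    ∃ t, 0 < t ∧ ∀ t', 0 < t' → s * t' - H t' ≤ s * t - H t := by
  -- The two thresholds are chosen so that near `0` and for large `t` the objective stays below its
  -- value at `t = 1`; the maximum can then be sought on a compact interval containing `1`.
  have h0 : ∀ᶠ t in 𝓝[>] (0 : ℝ), H 1 - s + |s| < H t := hH.tendsto_zero.eventually_gt_atTop _
  obtain ⟨δ, hδ, hδ'⟩ := mem_nhdsGT_iff_exists_Ioo_subset.1 h0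
  have hδ0 : 0 < δ := hδ
  have h1 : ∀ᶠ t in atTop, s + |H 1 - s| ≤ H t / t := hH.tendsto_atTop.eventually_ge_atTop _
  obtain ⟨M, hM⟩ := eventually_atTop.1 h1
  have hc : ContinuousOn (fun t => s * t - H t) (Icc (min (δ / 2) 1) (max M 1)) := by
    apply ContinuousOn.sub (by fun_prop)
    refine hH.contDiff.continuousOn.mono fun t ht => ?_
    exact lt_of_lt_of_le (by positivity) ht.1
  have hone : (1 : ℝ) ∈ Icc (min (δ / 2) 1) (max M 1) := ⟨min_le_right _ _, le_max_right _ _⟩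
  obtain ⟨t, ht, hmax⟩ := isCompact_Icc.exists_isMaxOn ⟨1, hone⟩ hc
  have htp : 0 < t := lt_of_lt_of_le (by positivity) ht.1
  refine ⟨t, htp, fun t' ht' => ?_⟩
  have hm1 : s * 1 - H 1 ≤ s * t - H t := hmax hone
  rcases lt_or_ge t' (min (δ / 2) 1) with hlt | hge
  · have hlt1 := hlt.trans_le (min_le_right _ _)
    have : H 1 - s + |s| < H t' :=
      hδ' ⟨ht', (hlt.trans_le (min_le_left _ _)).trans (by linarith)⟩
    have : s * t' ≤ |s| := by
      calc s * t' ≤ |s| * t' := by gcongr; exact le_abs_self s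
        _ ≤ |s| * 1 := by gcongr
        _ = |s| := mul_one _
    linarith
  · rcases lt_or_ge (max M 1) t' with hlt | hle
    · have ht1 : 1 < t' := (le_max_right _ _).trans_lt hlt
      have := hM t' ((le_max_left _ _).trans hlt.le)
      rw [le_div_iff₀ ht'] at this
      have h2 : |H 1 - s| ≤ |H 1 - s| * t' := le_mul_of_one_le_right (abs_nonneg _) ht1.le
      have := le_abs_self (H 1 - s)
      have := neg_abs_le (H 1 - s)
      nlinarith
    · exact hmax ⟨hge, hle⟩

theorem AssumptionA2.argmax_unique {H : ℝ → ℝ} (hH : AssumptionA2 H) {s t₁ t₂ : ℝ}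
    (h₁ : 0 < t₁) (h₂ : 0 < t₂) (hm₁ : ∀ t', 0 < t' → s * t' - H t' ≤ s * t₁ - H t₁)
    (hm₂ : ∀ t', 0 < t' → s * t' - H t' ≤ s * t₂ - H t₂) : t₁ = t₂ := by
  by_contra hne
  have := hH.strictConvex.2 (mem_Ioi.2 h₁) (mem_Ioi.2 h₂) hne
    (by norm_num : (0 : ℝ) < 1 / 2) (by norm_num : (0 : ℝ) < 1 / 2) (by norm_num)
  simp only [smul_eq_mul] at this
  have h3 := hm₁ (1 / 2 * t₁ + 1 / 2 * t₂) (by positivity)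
  have h4 := hm₂ t₁ h₁
  linarith

/-- The tangent line at `t` supports `H`, so `t` is the maximizer for `s = H'(t)`. This makes the
argmax map onto `(0, ∞)`, and a monotone map with this image has no jumps. -/
theorem AssumptionA2.exists_slope {H : ℝ → ℝ} (hH : AssumptionA2 H) {t : ℝ} (ht : 0 < t) :
    ∃ s, ∀ t', 0 < t' → s * t' - H t' ≤ s * t - H t := by
  have hd : DifferentiableAt ℝ H t :=
    (hH.contDiff.differentiableOn (by norm_num)).differentiableAt (Ioi_mem_nhds ht)
  refine ⟨deriv H t, fun t' ht' => ?_⟩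
  have hc := hH.strictConvex.convexOn
  rcases lt_trichotomy t t' with h | h | h
  · have := hc.deriv_le_slope (mem_Ioi.2 ht) (mem_Ioi.2 ht') h hd
    rw [slope_def_field, le_div_iff₀ (by linarith)] at this
    linarith
  · rw [h]
  · have := hc.slope_le_deriv (mem_Ioi.2 ht') (mem_Ioi.2 ht) h hd
    rw [slope_def_field, div_le_iff₀ (by linarith)] at this
    linarith

theorem AssumptionA2.exists_isLegendreTriple {H : ℝ → ℝ} (hH : AssumptionA2 H) :
    ∃ T A N, IsLegendreTriple H T A N := by
  choose T hT hmax using hH.exists_argmax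
  have hmono : Monotone T := by
    intro s s' hs
    rcases hs.eq_or_lt with rfl | hs
    · rfl
    have h1 := hmax s (T s') (hT s')
    have h2 := hmax s' (T s) (hT s)
    by_contra! hlt
    nlinarith
  have hsurj : ∀ t, 0 < t → ∃ s, T s = t := by
    intro t ht
    obtain ⟨s, hs⟩ := hH.exists_slope ht
    exact ⟨s, hH.argmax_unique (hT s) ht (hmax s) hs⟩
  have hcont : Continuous T := by
    rw [continuous_iff_continuousAt]
    intro s
    refine continuousAt_of_monotoneOn_of_image_mem_nhds (s := univ) (hmono.monotoneOn _)
      univ_mem ?_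
    filter_upwards [Ioi_mem_nhds (hT s)] with t ht
    obtain ⟨s', hs'⟩ := hsurj t ht
    exact ⟨s', mem_univ _, hs'⟩
  set A : ℝ → ℝ := fun s => s * T s - H (T s) with hA
  have hAmono : StrictMono A := by
    intro s s' hs
    have h2 := hmax s' (T s) (hT s)
    have := hT s
    simp only [hA]
    nlinarith
  have hAcont : Continuous A :=
    (continuous_id.mul hcont).sub (hH.contDiff.continuousOn.comp_continuous hcont hT)
  have htop : Tendsto A atTop atTop := by
    refine tendsto_atTop_mono (fun s => hmax s 1 one_pos) ?_
    simpa [sub_eq_add_neg] using tendsto_atTop_add_const_right atTop (-H 1) tendsto_id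
  have hbot : Tendsto A atBot atBot := by
    rw [tendsto_atBot]
    intro C
    obtain ⟨δ, hδ, hδ'⟩ := mem_nhdsGT_iff_exists_Ioo_subset.1
      (hH.tendsto_zero.eventually_gt_atTop (-C))
    have hδ0 : 0 < δ := hδ
    filter_upwards [eventually_le_atBot (min 0 ((C - |A 0|) / δ))] with s hs
    have hs0 : s ≤ 0 := hs.trans (min_le_left _ _)
    have hs1 : s * δ ≤ C - |A 0| := by
      rw [← le_div_iff₀ hδ0]; exact hs.trans (min_le_right _ _)
    -- If `T s < δ`, the blow-up of `H` at `0` gives `A s ≤ C`; otherwise `A s ≤ s δ + A 0`, which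
    -- is small for very negative `s`.
    have hTs := hT s
    simp only [hA]
    rcases lt_or_ge (T s) δ with h | h
    · have : -C < H (T s) := hδ' ⟨hTs, h⟩
      nlinarith
    · have h3 := hmax 0 (T s) hTs
      have h4 : -H (T s) ≤ A 0 := by simp only [hA]; linarith
      have := le_abs_self (A 0)
      nlinarith
  let e := hAmono.orderIsoOfSurjective A (hAcont.surjective htop hbot)
  refine ⟨T, A, e.symm, hT, hcont, hmono, fun s t ht => hmax s t ht, fun s => rfl, hAmono,
    e.symm.continuous, fun a => e.apply_symm_apply a, fun s => e.symm_apply_apply s⟩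

/-- Tangent inequality for the Legendre transform. -/
theorem IsLegendreTriple.tangent {H T A N : ℝ → ℝ} (h : IsLegendreTriple H T A N) (s s' : ℝ) :
    A s + T s * (s' - s) ≤ A s' := by
  have := h.fenchel s' (T s) (h.pos s)
  have := h.eq s
  nlinarith

theorem IsLegendreTriple.inv_mono {H T A N : ℝ → ℝ} (h : IsLegendreTriple H T A N) :
    Monotone N := by
  intro a b hab
  rw [← h.strictMono.le_iff_le, h.apply_inv, h.apply_inv]
  exact hab

theorem IsLegendreTriple.le_of_forall {H T A N : ℝ → ℝ} (h : IsLegendreTriple H T A N) {s a : ℝ}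
    (ha : ∀ t, 0 < t → s * t - H t ≤ a) : A s ≤ a := by
  rw [h.eq]
  exact ha _ (h.pos s)

/-! ### Two compactness lemmas -/

/-- A form of Fatou's lemma: the lower limit of a sequence of functions that are uniformly bounded
below and whose integrals converge. -/
theorem exists_integrable_liminf {X : Type*} [MeasurableSpace X] {μ : Measure X}
    [IsFiniteMeasure μ] {a : ℕ → X → ℝ} {C m : ℝ} (hint : ∀ n, Integrable (a n) μ)
    (hC : ∀ n, ∀ᵐ x ∂μ, C ≤ a n x) (hm : Tendsto (fun n => ∫ x, a n x ∂μ) atTop (𝓝 m)) :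
    ∃ b : X → ℝ, Integrable b μ ∧ ∫ x, b x ∂μ ≤ m ∧
      ∀ᵐ x ∂μ, ∀ ε > 0, ∃ᶠ n in atTop, a n x < b x + ε := by
  set g : ℕ → X → ℝ≥0∞ := fun n x => ENNReal.ofReal (a n x - C) with hg
  have hgm : ∀ n, AEMeasurable (g n) μ := fun n =>
    ((hint n).aestronglyMeasurable.aemeasurable.sub_const C).ennreal_ofReal
  have hgi : ∀ n, ∫⁻ x, g n x ∂μ = ENNReal.ofReal (∫ x, a n x ∂μ - C * μ.real univ) := by
    intro n
    have hi : Integrable (fun x => a n x - C) μ := (hint n).sub (integrable_const C)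
    rw [← ofReal_integral_eq_lintegral_ofReal hi
      (by filter_upwards [hC n] with x hx; simpa using hx), integral_sub (hint n)
      (integrable_const C), integral_const, smul_eq_mul, mul_comm]
  have hlim : Tendsto (fun n => ∫⁻ x, g n x ∂μ) atTop
      (𝓝 (ENNReal.ofReal (m - C * μ.real univ))) := by
    simp_rw [hgi]
    exact ENNReal.tendsto_ofReal (hm.sub_const _)
  set L : X → ℝ≥0∞ := fun x => liminf (fun n => g n x) atTop with hL
  have hLm : AEMeasurable L μ := by
    refine ⟨fun x => liminf (fun n => (hgm n).mk _ x) atTop,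
      Measurable.liminf fun n => (hgm n).measurable_mk, ?_⟩
    filter_upwards [ae_all_iff.2 fun n => (hgm n).ae_eq_mk] with x hx
    simp only [hL, hx]
  have hLi : ∫⁻ x, L x ∂μ ≤ ENNReal.ofReal (m - C * μ.real univ) :=
    (lintegral_liminf_le' hgm).trans hlim.liminf_eq.le
  have hLfin : ∫⁻ x, L x ∂μ ≠ ⊤ := (hLi.trans_lt ENNReal.ofReal_lt_top).ne
  have hLint : Integrable (fun x => (L x).toReal) μ := integrable_toReal_of_lintegral_ne_top hLm hLfin
  have hm0 : 0 ≤ m - C * μ.real univ := by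
    refine ge_of_tendsto' (hm.sub_const _) fun n => ?_
    have := integral_mono_ae (integrable_const C) (hint n) (hC n)
    rw [integral_const, smul_eq_mul] at this
    linarith
  refine ⟨fun x => (L x).toReal + C, hLint.add (integrable_const C), ?_, ?_⟩
  · rw [integral_add hLint (integrable_const C), integral_const, smul_eq_mul,
      integral_toReal hLm (ae_lt_top' hLm hLfin)]
    have := ENNReal.toReal_mono ENNReal.ofReal_ne_top hLi
    rw [ENNReal.toReal_ofReal hm0] at this
    linarith
  · filter_upwards [ae_lt_top' hLm hLfin] with x hx ε hε
    by_contra hcon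
    rw [not_frequently] at hcon
    have h1 : L x + ENNReal.ofReal ε ≤ L x := by
      conv_rhs => rw [hL]
      refine le_liminf_of_le (by isBoundedDefault) ?_
      filter_upwards [hcon] with n hn
      rw [hg, ← ENNReal.ofReal_toReal hx.ne, ← ENNReal.ofReal_add ENNReal.toReal_nonneg hε.le]
      apply ENNReal.ofReal_le_ofReal
      linarith
    have h2 : L x < L x + ENNReal.ofReal ε :=
      ENNReal.lt_add_right hx.ne (by simpa using hε)
    exact absurd h1 h2.not_ge

/-- Lipschitz functions that are bounded at a point have a pointwise convergent subsequence. -/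
theorem exists_tendsto_subseq_of_lipschitz {Y : Type*} [PseudoMetricSpace Y]
    [TopologicalSpace.SeparableSpace Y] {K : NNReal} {k : ℕ → Y → ℝ}
    (hk : ∀ n, LipschitzWith K (k n)) (o : Y) {C : ℝ} (hC : ∀ n, |k n o| ≤ C) :
    ∃ (k' : Y → ℝ) (φ : ℕ → ℕ), StrictMono φ ∧ LipschitzWith K k' ∧
      ∀ v, Tendsto (fun n => k (φ n) v) atTop (𝓝 (k' v)) := by
  have : Nonempty Y := ⟨o⟩
  let e := TopologicalSpace.denseSeq Y
  -- Compactness of a countable product of intervals over a dense sequence replaces the diagonal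
  -- argument; the Lipschitz bound measured from `o` gives the radii.
  have hcomp : IsCompact (univ.pi fun i : ℕ => Icc (-(C + K * dist (e i) o)) (C + K * dist (e i) o)) :=
    isCompact_univ_pi fun i => isCompact_Icc
  obtain ⟨a, -, φ, hφ, ha⟩ := hcomp.tendsto_subseq (x := fun n i => k n (e i)) (by
    intro n i _
    have h1 := (hk n).dist_le_mul (e i) o
    rw [Real.dist_eq] at h1
    refine abs_le.1 ?_
    have h2 := abs_sub_abs_le_abs_sub (k n (e i)) (k n o)
    have h3 := hC n
    show |k n (e i)| ≤ _
    linarith)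
  have hcs : ∀ v, ∃ l, Tendsto (fun n => k (φ n) v) atTop (𝓝 l) := by
    intro v
    apply cauchySeq_tendsto_of_complete
    rw [Metric.cauchySeq_iff]
    intro ε hε
    obtain ⟨i, hi⟩ := (TopologicalSpace.denseRange_denseSeq Y).exists_dist_lt v
      (ε := ε / (3 * (K + 1))) (by positivity)
    have hi' : K * dist v (e i) ≤ ε / 3 := by
      have h0 : (K : ℝ) * dist v (e i) ≤ (K + 1) * dist v (e i) := by
        have : 0 ≤ dist v (e i) := dist_nonneg
        nlinarith
      have h1 : ((K : ℝ) + 1) * dist v (e i) ≤ (K + 1) * (ε / (3 * (K + 1))) := by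
        gcongr
      have h2 : ((K : ℝ) + 1) * (ε / (3 * (K + 1))) = ε / 3 := by field_simp
      linarith
    have hci : CauchySeq (fun n => k (φ n) (e i)) := ((tendsto_pi_nhds.1 ha) i).cauchySeq
    obtain ⟨n₀, hn₀⟩ := Metric.cauchySeq_iff.1 hci (ε / 3) (by positivity)
    refine ⟨n₀, fun m hm n hn => ?_⟩
    have h1 := (hk (φ m)).dist_le_mul v (e i)
    have h2 := (hk (φ n)).dist_le_mul (e i) v
    have h3 := hn₀ m hm n hn
    rw [dist_comm (e i) v] at h2
    have h4 := dist_triangle4 (k (φ m) v) (k (φ m) (e i)) (k (φ n) (e i)) (k (φ n) v)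
    linarith
  choose k' hk' using hcs
  refine ⟨k', φ, hφ, LipschitzWith.of_dist_le_mul fun v v' => ?_, hk'⟩
  exact le_of_tendsto' ((hk' v).dist (hk' v')) fun n => (hk (φ n)).dist_le_mul v v'

/-! ### The dual problem -/

section Dual

variable {d : ℕ} {E : Type*} [NormedAddCommGroup E] [NormedSpace ℝ E]

/-- Competitors of the dual problem: `ℓ` dominates the Legendre-type transform of the Lipschitz
function `k`, and `h` dominates `f^*(J w)`. -/
structure IsFeasible (H : ℝ → ℝ) (f : Mat d → ℝ) (R : NNReal) (μ ν : Measure (Vec d))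
    (J : E →L[ℝ] Lp (Mat d) 1 μ) (k ℓ : Vec d → ℝ) (w : E) (h : Vec d → ℝ) : Prop where
  lipschitz : LipschitzWith R k
  integrable_left : Integrable ℓ ν
  integrable_right : Integrable h μ
  le_left : ∀ᵐ y ∂ν, ∀ v : Vec d, ∀ t : ℝ, 0 < t → inner ℝ y v - t * ℓ y - H t ≤ k v
  le_right : ∀ᵐ x ∂μ, ∀ ξ : Mat d, inner ℝ ξ (J w x) - f ξ ≤ h x

/-- The dual functional, to be minimized. -/
noncomputable def dualValue (F : Vec d → Vec d) {μ : Measure (Vec d)} (ν : Measure (Vec d))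
    (D : E →L[ℝ] Lp (Vec d) 1 μ) (k ℓ : Vec d → ℝ) (w : E) (h : Vec d → ℝ) : ℝ :=
  ∫ x, k (F x + D w x) ∂μ + ∫ x, h x ∂μ + ∫ y, ℓ y ∂ν

theorem abs_le_of_lipschitz {R : NNReal} {k : Vec d → ℝ} (hk : LipschitzWith R k) (v : Vec d) :
    |k v - k 0| ≤ R * ‖v‖ := by
  simpa [Real.dist_eq] using hk.dist_le_mul v 0

theorem integrable_comp_of_lipschitz {R : NNReal} {k : Vec d → ℝ} (hk : LipschitzWith R k)
    {μ : Measure (Vec d)} [IsFiniteMeasure μ] {G : Vec d → Vec d} (hG : Integrable G μ) :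
    Integrable (fun x => k (G x)) μ := by
  refine Integrable.mono' ((integrable_const |k 0|).add (hG.norm.const_mul (R : ℝ)))
    (hk.continuous.comp_aestronglyMeasurable hG.aestronglyMeasurable) (ae_of_all _ fun x => ?_)
  have h1 := abs_le_of_lipschitz hk (G x)
  have h2 := abs_sub_abs_le_abs_sub (k (G x)) (k 0)
  simp only [Real.norm_eq_abs, Pi.add_apply]
  linarith

theorem abs_integral_comp_sub_le {R : NNReal} {k : Vec d → ℝ} (hk : LipschitzWith R k)
    {μ : Measure (Vec d)} [IsFiniteMeasure μ] {G G' : Vec d → Vec d} (hG : Integrable G μ)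
    (hG' : Integrable G' μ) :
    |∫ x, k (G x) ∂μ - ∫ x, k (G' x) ∂μ| ≤ R * ∫ x, ‖G x - G' x‖ ∂μ := by
  rw [← integral_sub (integrable_comp_of_lipschitz hk hG) (integrable_comp_of_lipschitz hk hG'),
    ← integral_const_mul]
  refine (abs_integral_le_integral_abs).trans
    (integral_mono_ae ((integrable_comp_of_lipschitz hk hG).sub
      (integrable_comp_of_lipschitz hk hG')).abs ((hG.sub hG').norm.const_mul _)
      (ae_of_all _ fun x => ?_))
  simpa [Real.dist_eq, dist_eq_norm] using hk.dist_le_mul (G x) (G' x)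

variable {H : ℝ → ℝ} {f : Mat d → ℝ} {R : NNReal} {μ ν : Measure (Vec d)} {F : Vec d → Vec d}
  {J : E →L[ℝ] Lp (Mat d) 1 μ} {D : E →L[ℝ] Lp (Vec d) 1 μ}
  {k ℓ : Vec d → ℝ} {w : E} {h : Vec d → ℝ}

/-- The Lipschitz bound compares `k(F + div φ)` with `k 0`: up to an error linear in `‖w‖`, the
first dual term is the mass of `μ` times `k 0`. -/
theorem abs_integral_comp_le [IsFiniteMeasure μ] (hF : Integrable F μ) (hk : LipschitzWith R k) :
    |∫ x, k (F x + D w x) ∂μ - μ.real univ * k 0| ≤ R * (∫ x, ‖F x‖ ∂μ + ‖D‖ * ‖w‖) := by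
  have hD := L1.integrable_coeFn (D w)
  have h1 := abs_integral_comp_sub_le hk (hF.add hD) (integrable_const (0 : Vec d) (μ := μ))
  simp only [Pi.add_apply, integral_const, smul_eq_mul, sub_zero] at h1
  refine h1.trans ?_
  gcongr
  calc ∫ x, ‖F x + D w x‖ ∂μ ≤ ∫ x, (‖F x‖ + ‖D w x‖) ∂μ :=
        integral_mono (hF.add hD).norm (hF.norm.add hD.norm) fun x => norm_add_le _ _
    _ = ∫ x, ‖F x‖ ∂μ + ‖D w‖ := by
        rw [integral_add hF.norm hD.norm, L1.norm_eq_integral_norm]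
    _ ≤ _ := by gcongr; exact D.le_opNorm w

/-- This is the constraint at `v = 0`. Leaving `t` free lets the coercivity proof select the
coefficient of `k 0` in the bound. -/
theorem IsFeasible.integral_left_ge [IsFiniteMeasure ν] (hfe : IsFeasible H f R μ ν J k ℓ w h)
    {t : ℝ} (ht : 0 < t) : ν.real univ * ((-k 0 - H t) / t) ≤ ∫ y, ℓ y ∂ν := by
  rw [← smul_eq_mul, ← integral_const]
  refine integral_mono_ae (integrable_const _) hfe.integrable_left ?_
  filter_upwards [hfe.le_left] with y hy
  have := hy 0 t ht
  rw [inner_zero_right] at this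
  show (-k 0 - H t) / t ≤ ℓ y
  rw [div_le_iff₀ ht]
  linarith

/-- Testing with the vector of length `M` in the direction of `J w x` gives growth at rate `M`.
Since `M` is arbitrary, this term dominates any linear loss in `‖w‖`. -/
theorem IsFeasible.integral_right_ge [IsFiniteMeasure μ] (hfe : IsFeasible H f R μ ν J k ℓ w h)
    {M C : ℝ} (hM : 0 ≤ M) (hC : ∀ ξ, ‖ξ‖ ≤ M → f ξ ≤ C) :
    M * ‖J w‖ - C * μ.real univ ≤ ∫ x, h x ∂μ := by
  have hJ := L1.integrable_coeFn (J w)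
  have : M * ‖J w‖ - C * μ.real univ = ∫ x, (M * ‖J w x‖ - C) ∂μ := by
    rw [integral_sub (hJ.norm.const_mul M) (integrable_const C), integral_const_mul,
      integral_const, L1.norm_eq_integral_norm, smul_eq_mul, mul_comm C]
  rw [this]
  refine integral_mono_ae ((hJ.norm.const_mul M).sub (integrable_const C)) hfe.integrable_right ?_
  filter_upwards [hfe.le_right] with x hx
  show M * ‖J w x‖ - C ≤ h x
  have h1 := hx ((M * ‖J w x‖⁻¹) • J w x)
  have h2 : ‖(M * ‖J w x‖⁻¹) • J w x‖ ≤ M := by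
    rw [norm_smul, norm_mul, norm_inv, norm_norm, mul_assoc, Real.norm_of_nonneg hM]
    exact mul_le_of_le_one_right hM (inv_mul_le_one)
  have h3 := hC _ h2
  rw [inner_smul_left, real_inner_self_eq_norm_sq] at h1
  have h4 : M * ‖J w x‖⁻¹ * ‖J w x‖ ^ 2 = M * ‖J w x‖ := by
    rcases eq_or_ne ‖J w x‖ 0 with h0 | h0
    · simp [h0]
    · field_simp
  simp only [conj_trivial, h4] at h1
  linarith

/-- Coercivity of the dual functional. -/
theorem exists_dual_coercive [IsFiniteMeasure μ] [IsFiniteMeasure ν] [FiniteDimensional ℝ E]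
    [NeZero μ] [NeZero ν] (hJ : Function.Injective J) (hF : Integrable F μ)
    (hf : ∀ M, ∃ C, ∀ ξ, ‖ξ‖ ≤ M → f ξ ≤ C) :
    ∃ C, ∀ (k ℓ : Vec d → ℝ) (w : E) (h : Vec d → ℝ), IsFeasible H f R μ ν J k ℓ w h →
      μ.real univ / 2 * |k 0| + ‖w‖ ≤ dualValue F ν D k ℓ w h + C := by
  have hm : 0 < μ.real univ := measureReal_univ_pos
  have hn : 0 < ν.real univ := measureReal_univ_pos
  set m := μ.real univ
  set n := ν.real univ
  obtain ⟨κ, hκ, hanti⟩ := (J : E →ₗ[ℝ] Lp (Mat d) 1 μ).exists_antilipschitzWith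
    (LinearMap.ker_eq_bot.2 hJ)
  have hJw : ∀ w, ‖w‖ ≤ κ * ‖J w‖ := fun w => by
    simpa [dist_eq_norm] using hanti.le_mul_dist w 0
  -- This radius makes the `h` term absorb the loss `R ‖D‖ ‖w‖` and still leave a full `‖w‖`.
  obtain ⟨C₁, hC₁⟩ := hf (κ * (R * ‖D‖ + 1))
  refine ⟨R * ∫ x, ‖F x‖ ∂μ + C₁ * m + |m / 2 * H (2 * n / m)| + |2 * m * H (n / (2 * m))|,
    fun k ℓ w h hfe => ?_⟩
  have ha := (abs_le.1 (abs_integral_comp_le (D := D) (w := w) hF hfe.lipschitz)).1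
  have hb := hfe.integral_right_ge (by positivity) hC₁
  have hb' : (R * ‖D‖ + 1) * ‖w‖ ≤ κ * (R * ‖D‖ + 1) * ‖J w‖ := by
    calc (R * ‖D‖ + 1) * ‖w‖ ≤ (R * ‖D‖ + 1) * (κ * ‖J w‖) := by gcongr; exact hJw w
      _ = _ := by ring
  -- The first `t` contributes `-(m/2) k 0`, the second `-2m k 0`. Added to `m k 0` they leave
  -- `(m/2) k 0` and `-m k 0`, which serve for positive and negative `k 0` respectively.
  have hc₁ := hfe.integral_left_ge (t := 2 * n / m) (by positivity)
  have hc₂ := hfe.integral_left_ge (t := n / (2 * m)) (by positivity)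
  have e₁ : n * ((-k 0 - H (2 * n / m)) / (2 * n / m)) = - (m / 2 * k 0) - m / 2 * H (2 * n / m) := by
    field_simp
  have e₂ : n * ((-k 0 - H (n / (2 * m))) / (n / (2 * m)))
      = - (2 * m * k 0) - 2 * m * H (n / (2 * m)) := by
    field_simp
  rw [e₁] at hc₁
  rw [e₂] at hc₂
  have a₁ := le_abs_self (m / 2 * H (2 * n / m))
  have a₂ := le_abs_self (2 * m * H (n / (2 * m)))
  have a₁' := abs_nonneg (m / 2 * H (2 * n / m))
  have a₂' := abs_nonneg (2 * m * H (n / (2 * m)))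
  unfold dualValue
  rcases abs_cases (k 0) with ⟨hk, hk0⟩ | ⟨hk, hk0⟩ <;> rw [hk] <;> nlinarith

theorem IsFeasible.left_ge (hfe : IsFeasible H f R μ ν J k ℓ w h) :
    ∀ᵐ y ∂ν, -k 0 - H 1 ≤ ℓ y := by
  filter_upwards [hfe.le_left] with y hy
  have := hy 0 1 one_pos
  rw [inner_zero_right] at this
  linarith

theorem IsFeasible.right_ge (hfe : IsFeasible H f R μ ν J k ℓ w h) :
    ∀ᵐ x ∂μ, -f 0 ≤ h x := by
  filter_upwards [hfe.le_right] with x hx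
  have := hx 0
  rw [inner_zero_left] at this
  linarith

/-- The competitor `φ = 0`, `k = R‖·‖` shows that the dual problem is not void. -/
theorem exists_isFeasible [IsFiniteMeasure μ] [IsFiniteMeasure ν] {T A N : ℝ → ℝ}
    (hA : IsLegendreTriple H T A N) {b : ℝ} (hb : ∀ ξ, b ≤ f ξ) (hνR : ∀ᵐ y ∂ν, ‖y‖ ≤ R) :
    ∃ (k ℓ : Vec d → ℝ) (w : E) (h : Vec d → ℝ), IsFeasible H f R μ ν J k ℓ w h := by
  refine ⟨fun v => R * ‖v‖, fun _ => -N 0, 0, fun _ => -b, ?_, integrable_const _,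
    integrable_const _, ?_, ?_⟩
  · refine LipschitzWith.of_dist_le_mul fun v v' => ?_
    rw [Real.dist_eq, ← mul_sub, abs_mul, NNReal.abs_eq, dist_eq_norm]
    gcongr
    exact abs_norm_sub_norm_le v v'
  · filter_upwards [hνR] with y hy v t ht
    have h1 := hA.fenchel (N 0) t ht
    rw [hA.apply_inv] at h1
    have h2 := real_inner_le_norm y v
    have h3 : ‖y‖ * ‖v‖ ≤ R * ‖v‖ := by gcongr
    linarith
  · rw [map_zero]
    filter_upwards [Lp.coeFn_zero (Mat d) 1 μ] with x hx ξ
    rw [hx, Pi.zero_apply, inner_zero_right]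
    linarith [hb ξ]

/-- For the fixed argument `w'` this is dominated convergence; moving the argument to `w n` costs at
most `R ‖D (w n) - D w'‖`, uniformly in the potentials. -/
theorem tendsto_integral_comp [IsFiniteMeasure μ] (hF : Integrable F μ) {k : ℕ → Vec d → ℝ}
    {k' : Vec d → ℝ} {w : ℕ → E} {w' : E} (hk : ∀ n, LipschitzWith R (k n))
    (hk' : ∀ v, Tendsto (fun n => k n v) atTop (𝓝 (k' v))) (hw : Tendsto w atTop (𝓝 w')) :
    Tendsto (fun n => ∫ x, k n (F x + D (w n) x) ∂μ) atTop (𝓝 (∫ x, k' (F x + D w' x) ∂μ)) := by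
  have hi : ∀ w, Integrable (fun x => F x + D w x) μ := fun w =>
    hF.add (L1.integrable_coeFn (D w))
  obtain ⟨C, hC⟩ : ∃ C, ∀ n, |k n 0| ≤ C := by
    obtain ⟨C, hC⟩ := (hk' 0).abs.bddAbove_range
    exact ⟨C, fun n => hC ⟨n, rfl⟩⟩
  have h1 : Tendsto (fun n => ∫ x, k n (F x + D w' x) ∂μ) atTop
      (𝓝 (∫ x, k' (F x + D w' x) ∂μ)) := by
    refine tendsto_integral_of_dominated_convergence (fun x => C + R * ‖F x + D w' x‖)
      (fun n => (integrable_comp_of_lipschitz (hk n) (hi w')).aestronglyMeasurable)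
      ((integrable_const C).add ((hi w').norm.const_mul _)) (fun n => ae_of_all _ fun x => ?_)
      (ae_of_all _ fun x => hk' _)
    have h1 := abs_le_of_lipschitz (hk n) (F x + D w' x)
    have h2 := abs_sub_abs_le_abs_sub (k n (F x + D w' x)) (k n 0)
    have := hC n
    rw [Real.norm_eq_abs]
    linarith
  have h2 : Tendsto (fun n => ∫ x, k n (F x + D (w n) x) ∂μ - ∫ x, k n (F x + D w' x) ∂μ) atTop
      (𝓝 0) := by
    have h3 : Tendsto (fun n => R * ‖D (w n) - D w'‖) atTop (𝓝 0) := by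
      have : Tendsto (fun n => D (w n) - D w') atTop (𝓝 0) := by
        simpa using ((D.continuous.tendsto w').comp hw).sub_const (D w')
      simpa using this.norm.const_mul (R : ℝ)
    refine squeeze_zero_norm (fun n => ?_) h3
    refine (abs_integral_comp_sub_le (hk n) (hi (w n)) (hi w')).trans (le_of_eq ?_)
    rw [L1.norm_eq_integral_norm]
    congr 1
    refine integral_congr_ae ?_
    filter_upwards [Lp.coeFn_sub (D (w n)) (D w')] with x hx
    rw [hx, Pi.sub_apply, add_sub_add_left_eq_sub]
  simpa using h2.add h1

/-- Along a minimizing sequence `k` converges pointwise and `w` in norm, while `ℓ` and `h` are only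
replaced by lower limits. That suffices: the lower limits still satisfy the constraints and do not
raise the integrals. -/
theorem exists_dual_minimizer [IsFiniteMeasure μ] [IsFiniteMeasure ν] [FiniteDimensional ℝ E]
    {T A N : ℝ → ℝ} (hA : IsLegendreTriple H T A N)
    [NeZero μ] [NeZero ν] (hJ : Function.Injective J) (hF : Integrable F μ)
    (hf : ∀ M, ∃ C, ∀ ξ, ‖ξ‖ ≤ M → f ξ ≤ C) {b : ℝ} (hb : ∀ ξ, b ≤ f ξ)
    (hνR : ∀ᵐ y ∂ν, ‖y‖ ≤ R) :
    ∃ (k ℓ : Vec d → ℝ) (w : E) (h : Vec d → ℝ), IsFeasible H f R μ ν J k ℓ w h ∧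
      ∀ (k' ℓ' : Vec d → ℝ) (w' : E) (h' : Vec d → ℝ), IsFeasible H f R μ ν J k' ℓ' w' h' →
        dualValue F ν D k ℓ w h ≤ dualValue F ν D k' ℓ' w' h' := by
  obtain ⟨C, hC⟩ := exists_dual_coercive (H := H) (R := R) (D := D) (ν := ν) hJ hF hf
  have hm : 0 < μ.real univ := measureReal_univ_pos
  set vals : Set ℝ := {a | ∃ (k ℓ : Vec d → ℝ) (w : E) (h : Vec d → ℝ),
    IsFeasible H f R μ ν J k ℓ w h ∧ dualValue F ν D k ℓ w h = a} with hvals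
  have hne : vals.Nonempty := by
    obtain ⟨k, ℓ, w, h, hfe⟩ := exists_isFeasible (E := E) (μ := μ) (J := J) hA hb hνR
    exact ⟨_, k, ℓ, w, h, hfe, rfl⟩
  have hbdd : BddBelow vals := by
    refine ⟨-C, ?_⟩
    rintro _ ⟨k, ℓ, w, h, hfe, rfl⟩
    have := hC k ℓ w h hfe
    have : 0 ≤ μ.real univ / 2 * |k 0| + ‖w‖ := by positivity
    linarith
  obtain ⟨u, hu, hlim, hmem⟩ := exists_seq_tendsto_sInf hne hbdd
  choose k ℓ w h hfe hval using hmem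
  have hle : ∀ n, μ.real univ / 2 * |k n 0| + ‖w n‖ ≤ u 0 + C := fun n => by
    have := hC _ _ _ _ (hfe n)
    rw [hval] at this
    linarith [hu (Nat.zero_le n)]
  have hw : ∀ n, ‖w n‖ ≤ u 0 + C := fun n => by
    have := hle n
    have : 0 ≤ μ.real univ / 2 * |k n 0| := by positivity
    linarith
  obtain ⟨Ck, hk⟩ : ∃ Ck, ∀ n, |k n 0| ≤ Ck := by
    refine ⟨(u 0 + C) / (μ.real univ / 2), fun n => ?_⟩
    rw [le_div_iff₀ (by positivity)]
    have := hle n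
    have := norm_nonneg (w n)
    linarith
  obtain ⟨k', φ, hφ, hk'lip, hk'⟩ := exists_tendsto_subseq_of_lipschitz
    (fun n => (hfe n).lipschitz) 0 hk
  obtain ⟨w', -, ψ, hψ, hw'⟩ := tendsto_subseq_of_bounded
    (Metric.isBounded_closedBall (x := (0 : E)) (r := u 0 + C)) (x := w ∘ φ)
    (fun n => by simpa using hw (φ n))
  have hJw : Tendsto (fun n => J (w (φ (ψ n)))) atTop (𝓝 (J w')) :=
    (J.continuous.tendsto w').comp hw'
  obtain ⟨χ, hχ, hJae⟩ := (tendstoInMeasure_of_tendsto_Lp hJw).exists_seq_tendsto_ae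
  set θ₀ : ℕ → ℕ := fun n => φ (ψ (χ n)) with hθ₀
  have hθ₀m : StrictMono θ₀ := hφ.comp (hψ.comp hχ)
  have hk₀ : ∀ v, Tendsto (fun n => k (θ₀ n) v) atTop (𝓝 (k' v)) := fun v =>
    (hk' v).comp (hψ.comp hχ).tendsto_atTop
  have hw₀ : Tendsto (fun n => w (θ₀ n)) atTop (𝓝 w') := hw'.comp hχ.tendsto_atTop
  have ha₀ := tendsto_integral_comp (D := D) hF (fun n => (hfe (θ₀ n)).lipschitz) hk₀ hw₀
  have hu₀ : Tendsto (fun n => ∫ x, h (θ₀ n) x ∂μ + ∫ y, ℓ (θ₀ n) y ∂ν) atTop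
      (𝓝 (sInf vals - ∫ x, k' (F x + D w' x) ∂μ)) := by
    refine ((hlim.comp hθ₀m.tendsto_atTop).sub ha₀).congr fun n => ?_
    simp only [Function.comp_apply, ← hval (θ₀ n), dualValue]
    ring
  have hhge : ∀ n, -f 0 * μ.real univ ≤ ∫ x, h n x ∂μ := fun n => by
    have := integral_mono_ae (integrable_const (-f 0)) (hfe n).integrable_right (hfe n).right_ge
    rwa [integral_const, smul_eq_mul, mul_comm] at this
  have hℓge' : ∀ n, ∀ᵐ y ∂ν, -Ck - H 1 ≤ ℓ n y := fun n => by
    filter_upwards [(hfe n).left_ge] with y hy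
    have := (abs_le.1 (hk n)).2
    linarith
  have hℓge : ∀ n, (-Ck - H 1) * ν.real univ ≤ ∫ y, ℓ n y ∂ν := fun n => by
    have := integral_mono_ae (integrable_const (-Ck - H 1)) (hfe n).integrable_left (hℓge' n)
    rwa [integral_const, smul_eq_mul, mul_comm] at this
  obtain ⟨Cu, hCu⟩ := hu₀.bddAbove_range
  have hCu' : ∀ n, ∫ x, h (θ₀ n) x ∂μ + ∫ y, ℓ (θ₀ n) y ∂ν ≤ Cu := fun n => hCu ⟨n, rfl⟩
  -- Only the sum of the two integrals is known to converge. Each is bounded below, so a further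
  -- subsequence makes them converge separately, as the Fatou lemma requires.
  obtain ⟨β, -, ρ, hρ, hβ⟩ := tendsto_subseq_of_bounded
    (Metric.isBounded_Icc (-f 0 * μ.real univ) (Cu - (-Ck - H 1) * ν.real univ))
    (x := fun n => ∫ x, h (θ₀ n) x ∂μ)
    (fun n => ⟨hhge _, by linarith [hCu' n, hℓge (θ₀ n)]⟩)
  set θ : ℕ → ℕ := fun n => θ₀ (ρ n) with hθ
  have hβ' : Tendsto (fun n => ∫ x, h (θ n) x ∂μ) atTop (𝓝 β) := hβ
  have hγ' : Tendsto (fun n => ∫ y, ℓ (θ n) y ∂ν) atTop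
      (𝓝 (sInf vals - ∫ x, k' (F x + D w' x) ∂μ - β)) := by
    refine ((hu₀.comp hρ.tendsto_atTop).sub hβ).congr fun n => ?_
    simp only [Function.comp_apply, hθ]
    ring
  obtain ⟨h', hh'i, hh'le, hh'⟩ := exists_integrable_liminf
    (fun n => (hfe (θ n)).integrable_right) (fun n => (hfe (θ n)).right_ge) hβ'
  obtain ⟨ℓ', hℓ'i, hℓ'le, hℓ'⟩ := exists_integrable_liminf
    (fun n => (hfe (θ n)).integrable_left) (fun n => hℓge' (θ n)) hγ'
  refine ⟨k', ℓ', w', h', ⟨hk'lip, hℓ'i, hh'i, ?_, ?_⟩, fun k₁ ℓ₁ w₁ h₁ hfe₁ => ?_⟩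
  · filter_upwards [hℓ', ae_all_iff.2 fun n => (hfe (θ n)).le_left] with y hy hn v t ht
    refine le_of_forall_pos_le_add fun ε hε => ?_
    have hlk : Tendsto (fun n => k (θ n) v) atTop (𝓝 (k' v)) :=
      (hk₀ v).comp hρ.tendsto_atTop
    by_contra! hcon
    have hev := hlk.eventually_lt_const (u := inner ℝ y v - t * ℓ' y - H t - ε) (by linarith)
    -- The lower limit is nearly reached at infinitely many indices and `k (θ n) v` is close to its
    -- limit at all late ones, so some index serves both.
    obtain ⟨n, hn1, hn2⟩ := ((hy (ε / t) (by positivity)).and_eventually hev).exists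
    have h1 := hn n v t ht
    have h2 : t * ℓ (θ n) y < t * (ℓ' y + ε / t) := by gcongr
    have h3 : t * (ℓ' y + ε / t) = t * ℓ' y + ε := by field_simp
    linarith
  · filter_upwards [hh', hJae, ae_all_iff.2 fun n => (hfe (θ n)).le_right] with x hx hJx hn ξ
    refine le_of_forall_pos_le_add fun ε hε => ?_
    have hlJ : Tendsto (fun n => inner ℝ ξ (J (w (θ n)) x)) atTop (𝓝 (inner ℝ ξ (J w' x))) :=
      (tendsto_const_nhds.inner hJx).comp hρ.tendsto_atTop
    by_contra! hcon
    have hev := hlJ.eventually_const_lt (u := f ξ + h' x + ε) (by linarith)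
    obtain ⟨n, hn1, hn2⟩ := ((hx ε hε).and_eventually hev).exists
    have h1 := hn n ξ
    linarith
  · have h1 : sInf vals ≤ dualValue F ν D k₁ ℓ₁ w₁ h₁ :=
      csInf_le hbdd ⟨k₁, ℓ₁, w₁, h₁, hfe₁, rfl⟩
    refine le_trans ?_ h1
    unfold dualValue
    linarith

end Dual

/-! ### Envelopes of affine functions -/

section Envelope

variable {d : ℕ}

/-- The upper envelope `v ↦ sup_{y ∈ G} (y · v + c y)`. -/
noncomputable def envelope (G : Set (Vec d)) (c : Vec d → ℝ) (v : Vec d) : ℝ :=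
  ⨆ y : G, (inner ℝ (y : Vec d) v + c y)

theorem le_envelope {G : Set (Vec d)} {c k : Vec d → ℝ}
    (hk : ∀ y ∈ G, ∀ v, inner ℝ y v + c y ≤ k v) {y : Vec d} (hy : y ∈ G) (v : Vec d) :
    inner ℝ y v + c y ≤ envelope G c v :=
  le_ciSup (f := fun y : G => inner ℝ (y : Vec d) v + c y)
    ⟨k v, by rintro _ ⟨y, rfl⟩; exact hk y y.2 v⟩ ⟨y, hy⟩

theorem envelope_le {G : Set (Vec d)} {c k : Vec d → ℝ} (hG : G.Nonempty)
    (hk : ∀ y ∈ G, ∀ v, inner ℝ y v + c y ≤ k v) (v : Vec d) : envelope G c v ≤ k v := by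
  have := hG.to_subtype
  exact ciSup_le fun y => hk y y.2 v

theorem exists_lt_envelope {G : Set (Vec d)} {c : Vec d → ℝ} (hG : G.Nonempty) (v : Vec d)
    {δ : ℝ} (hδ : 0 < δ) : ∃ y ∈ G, envelope G c v - δ < inner ℝ y v + c y := by
  have := hG.to_subtype
  obtain ⟨y, hy⟩ := exists_lt_of_lt_ciSup (show envelope G c v - δ < envelope G c v by linarith)
  exact ⟨y, y.2, hy⟩

theorem lipschitzWith_envelope {G : Set (Vec d)} {c k : Vec d → ℝ} {R : NNReal}
    (hG : G.Nonempty) (hR : ∀ y ∈ G, ‖y‖ ≤ R) (hk : ∀ y ∈ G, ∀ v, inner ℝ y v + c y ≤ k v) :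
    LipschitzWith R (envelope G c) := by
  have := hG.to_subtype
  refine LipschitzWith.of_le_add_mul R fun v v' => ciSup_le fun y => ?_
  have h1 := le_envelope hk y.2 v'
  have h2 : inner ℝ (y : Vec d) (v - v') ≤ R * dist v v' := by
    refine (real_inner_le_norm _ _).trans ?_
    rw [dist_eq_norm]
    gcongr
    exact hR y y.2
  rw [inner_sub_right] at h2
  linarith

/-- Slopes of almost supporting affine minorants converge to the gradient. -/
theorem tendsto_of_almost_supporting {k : Vec d → ℝ} {v u : Vec d} (hu : HasGradientAt k u v)
    {y : ℕ → Vec d} {c δ : ℕ → ℝ} (hle : ∀ n v', inner ℝ (y n) v' + c n ≤ k v')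
    (hδ : Tendsto δ atTop (𝓝 0)) (hge : ∀ n, k v - δ n ≤ inner ℝ (y n) v + c n) :
    Tendsto y atTop (𝓝 u) ∧ Tendsto c atTop (𝓝 (k v - inner ℝ u v)) := by
  have hy : Tendsto y atTop (𝓝 u) := by
    rw [Metric.tendsto_atTop']
    intro ε hε
    have hO := hasGradientAt_iff_isLittleO.1 hu
    obtain ⟨r, hr, hball⟩ := Metric.eventually_nhds_iff.1 (hO.def (half_pos hε))
    obtain ⟨n₀, hn₀⟩ := eventually_atTop.1
      (hδ.eventually_lt_const (show 0 < ε / 2 * (r / 2) by positivity))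
    refine ⟨n₀, fun n hn => ?_⟩
    rw [dist_eq_norm]
    rcases eq_or_ne (y n) u with heq | hne
    · simpa [heq] using hε
    have hpos : 0 < ‖y n - u‖ := norm_pos_iff.2 (sub_ne_zero.2 hne)
    -- A step of length `r / 2` along the error `y n - u`: the affine minorant gains `r / 2 * ‖y n -
    -- u‖` over the linearization of `k`, which only the little-o term and `δ n` can pay for.
    set η : Vec d := (r / 2 * ‖y n - u‖⁻¹) • (y n - u) with hη
    have hηn : ‖η‖ = r / 2 := by
      rw [hη, norm_smul, norm_mul, norm_inv, norm_norm, Real.norm_of_nonneg (by positivity)]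
      field_simp
    have hηi : inner ℝ (y n - u) η = r / 2 * ‖y n - u‖ := by
      rw [hη, inner_smul_right, real_inner_self_eq_norm_sq]
      field_simp
    have h1 := hball (y := v + η) (by simp [dist_eq_norm, hηn]; linarith)
    simp only [add_sub_cancel_left, hηn] at h1
    have h2 := (abs_le.1 (Real.norm_eq_abs _ ▸ h1)).2
    have h3 := hle n (v + η)
    have h4 := hge n
    rw [inner_add_right] at h3
    rw [inner_sub_left] at hηi
    have h5 := hn₀ n hn.le
    have h6 : r / 2 * ‖y n - u‖ < r / 2 * ε := by nlinarith
    exact lt_of_mul_lt_mul_left h6 (by positivity)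
  refine ⟨hy, ?_⟩
  have h1 : Tendsto (fun n => k v - inner ℝ (y n) v) atTop (𝓝 (k v - inner ℝ u v)) :=
    tendsto_const_nhds.sub (hy.inner tendsto_const_nhds)
  have h2 : Tendsto (fun n => k v - inner ℝ (y n) v - δ n) atTop (𝓝 (k v - inner ℝ u v)) := by
    simpa using h1.sub hδ
  exact tendsto_of_tendsto_of_tendsto_of_le_of_le h2 h1
    (fun n => by have := hge n; simp only; linarith)
    (fun n => by have := hle n v; simp only; linarith)

/-- The potentials `k` and `ℓ` determine each other: `k` is the envelope of the affine functions
`v ↦ y · v + A (-ℓ y)`, and these are all its affine minorants with slope in `K`. -/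
structure IsConjugatePair (A : ℝ → ℝ) (K G : Set (Vec d)) (k ℓ : Vec d → ℝ) : Prop where
  nonempty : G.Nonempty
  subset : G ⊆ K
  le : ∀ y ∈ G, ∀ v, inner ℝ y v + A (-ℓ y) ≤ k v
  exists_lt : ∀ v, ∀ δ : ℝ, 0 < δ → ∃ y ∈ G, k v - δ < inner ℝ y v + A (-ℓ y)
  maximal : ∀ y ∈ K, ∀ c : ℝ, (∀ v, inner ℝ y v + c ≤ k v) → y ∈ G ∧ c ≤ A (-ℓ y)

variable {H T A N : ℝ → ℝ} {K G : Set (Vec d)} {k ℓ : Vec d → ℝ}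

/-- The limiting affine function is again a minorant of `k`, touching at `v`, so maximality places
`u` in `G` and identifies the limiting intercept as `A (-ℓ u)`. Continuity of `N` turns this into
convergence of `ℓ` along the sequence, without assuming `ℓ` continuous. -/
theorem IsConjugatePair.tendsto (hp : IsConjugatePair A K G k ℓ) (hA : IsLegendreTriple H T A N)
    (hK : IsClosed K) {v u : Vec d} (hu : HasGradientAt k u v) {y : ℕ → Vec d} {δ : ℕ → ℝ}
    (hy : ∀ n, y n ∈ G) (hδ : Tendsto δ atTop (𝓝 0))
    (hge : ∀ n, k v - δ n ≤ inner ℝ (y n) v + A (-ℓ (y n))) :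
    Tendsto y atTop (𝓝 u) ∧ Tendsto (fun n => ℓ (y n)) atTop (𝓝 (ℓ u)) ∧ u ∈ G ∧
      inner ℝ u v + A (-ℓ u) = k v := by
  obtain ⟨h1, h2⟩ := tendsto_of_almost_supporting hu (c := fun n => A (-ℓ (y n)))
    (fun n v' => hp.le _ (hy n) v') hδ hge
  have huK : u ∈ K := hK.mem_of_tendsto h1 (Eventually.of_forall fun n => hp.subset (hy n))
  have h3 : ∀ v', inner ℝ u v' + (k v - inner ℝ u v) ≤ k v' := fun v' =>
    le_of_tendsto' ((h1.inner tendsto_const_nhds).add h2) fun n => hp.le _ (hy n) v'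
  obtain ⟨huG, h4⟩ := hp.maximal u huK _ h3
  have h5 : inner ℝ u v + A (-ℓ u) = k v := le_antisymm (hp.le u huG v) (by linarith)
  refine ⟨h1, ?_, huG, h5⟩
  have h6 : Tendsto (fun n => N (A (-ℓ (y n)))) atTop (𝓝 (N (A (-ℓ u)))) := by
    refine (hA.cont_inv.tendsto _).comp ?_
    rwa [show A (-ℓ u) = k v - inner ℝ u v by linarith]
  simp only [hA.inv_apply] at h6
  simpa using h6.neg

theorem IsConjugatePair.gradient_mem (hp : IsConjugatePair A K G k ℓ)
    (hA : IsLegendreTriple H T A N) (hK : IsClosed K) {v u : Vec d} (hu : HasGradientAt k u v) :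
    u ∈ G ∧ inner ℝ u v + A (-ℓ u) = k v := by
  choose y hy hlt using fun n : ℕ => hp.exists_lt v (1 / ((n : ℝ) + 1)) (by positivity)
  obtain ⟨-, -, h1, h2⟩ := hp.tendsto hA hK hu hy tendsto_one_div_add_atTop_nhds_zero_nat
    fun n => (hlt n).le
  exact ⟨h1, h2⟩

/-- With `T` monotone this bounds the future density `T (-ℓ y)` on `G` and supplies the dominating
constants below. -/
theorem IsConjugatePair.neg_le (hp : IsConjugatePair A K G k ℓ) (hA : IsLegendreTriple H T A N)
    {y : Vec d} (hy : y ∈ G) : -ℓ y ≤ N (k 0) := by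
  have := hp.le y hy 0
  rw [inner_zero_right, zero_add] at this
  have := hA.inv_mono this
  rwa [hA.inv_apply] at this

/-! ### Perturbation of `ℓ` -/

/-- The tangents of `A` at the perturbed and at the unperturbed argument bracket the increment; both
slopes are bounded because the arguments stay below `N (k 0) + M`. -/
theorem IsConjugatePair.perturb_le (hp : IsConjugatePair A K G k ℓ)
    (hA : IsLegendreTriple H T A N) {l : Vec d → ℝ} {M : ℝ} (hM : ∀ y, |l y| ≤ M) {e : ℝ}
    (he : 0 ≤ e) (he1 : e ≤ 1) {y : Vec d} (hy : y ∈ G) :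
    A (-(ℓ y + e * l y)) ≤ A (-ℓ y) - e * (T (-(ℓ y + e * l y)) * l y) ∧
    A (-ℓ y) - e * (T (-ℓ y) * l y) ≤ A (-(ℓ y + e * l y)) ∧
    |T (-(ℓ y + e * l y)) * l y| ≤ T (N (k 0) + M) * M ∧
    |T (-ℓ y) * l y| ≤ T (N (k 0) + M) * M := by
  have hM0 : 0 ≤ M := (abs_nonneg _).trans (hM y)
  have hb := hp.neg_le hA hy
  have hel : |e * l y| ≤ M := by
    rw [abs_mul, abs_of_nonneg he]
    exact (mul_le_of_le_one_left (abs_nonneg _) he1).trans (hM y)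
  have hel' := (abs_le.1 hel).1
  have aux : ∀ s, s ≤ N (k 0) + M → |T s * l y| ≤ T (N (k 0) + M) * M := fun s hs => by
    rw [abs_mul, abs_of_pos (hA.pos s)]
    exact mul_le_mul (hA.mono hs) (hM y) (abs_nonneg _) (hA.pos _).le
  refine ⟨?_, ?_, aux _ (by linarith), aux _ (by linarith)⟩
  · have := hA.tangent (-(ℓ y + e * l y)) (-ℓ y)
    nlinarith
  · have := hA.tangent (-ℓ y) (-(ℓ y + e * l y))
    nlinarith

/-- The envelope that belongs to `ℓ + e l`. -/
noncomputable def perturbed (A : ℝ → ℝ) (G : Set (Vec d)) (ℓ l : Vec d → ℝ) (e : ℝ) : Vec d → ℝ :=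
  envelope G fun y => A (-(ℓ y + e * l y))

theorem IsConjugatePair.perturbed_aux (hp : IsConjugatePair A K G k ℓ)
    (hA : IsLegendreTriple H T A N) {l : Vec d → ℝ} {M : ℝ} (hM : ∀ y, |l y| ≤ M) {e : ℝ}
    (he : 0 ≤ e) (he1 : e ≤ 1) : ∀ y ∈ G, ∀ v,
    inner ℝ y v + A (-(ℓ y + e * l y)) ≤ k v + e * (T (N (k 0) + M) * M) := by
  intro y hy v
  obtain ⟨h1, -, h3, -⟩ := hp.perturb_le hA hM he he1 hy
  have := hp.le y hy v
  have := (abs_le.1 h3).1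
  nlinarith

theorem IsConjugatePair.abs_perturbed_sub_le (hp : IsConjugatePair A K G k ℓ)
    (hA : IsLegendreTriple H T A N) {l : Vec d → ℝ} {M : ℝ} (hM : ∀ y, |l y| ≤ M) {e : ℝ}
    (he : 0 ≤ e) (he1 : e ≤ 1) (v : Vec d) :
    |perturbed A G ℓ l e v - k v| ≤ e * (T (N (k 0) + M) * M) := by
  have haux := hp.perturbed_aux hA hM he he1
  rw [abs_le]
  constructor
  · refine le_of_forall_pos_le_add fun δ hδ => ?_
    obtain ⟨y, hy, hlt⟩ := hp.exists_lt v δ hδ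
    have h0 : inner ℝ y v + A (-(ℓ y + e * l y)) ≤ perturbed A G ℓ l e v :=
      le_envelope (k := fun v => k v + e * (T (N (k 0) + M) * M)) haux hy v
    obtain ⟨-, h2, -, h4⟩ := hp.perturb_le hA hM he he1 hy
    have := (abs_le.1 h4).2
    nlinarith
  · have : perturbed A G ℓ l e v ≤ _ :=
      envelope_le (k := fun v => k v + e * (T (N (k 0) + M) * M)) hp.nonempty haux v
    linarith

/-- An envelope theorem: a supremum is differentiated in its parameter at the maximizer, here `u =
∇k(v)`. Using `u` as competitor gives the lower bound; near-maximizers of the perturbed envelope,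
which almost support `k` and so converge to `u`, give the upper bound. -/
theorem IsConjugatePair.tendsto_perturbed (hp : IsConjugatePair A K G k ℓ)
    (hA : IsLegendreTriple H T A N) (hK : IsClosed K) {l : Vec d → ℝ} (hl : Continuous l) {M : ℝ}
    (hM : ∀ y, |l y| ≤ M) {v u : Vec d} (hu : HasGradientAt k u v) {e : ℕ → ℝ}
    (he : ∀ n, 0 < e n) (he1 : ∀ n, e n ≤ 1) (hlim : Tendsto e atTop (𝓝 0)) :
    Tendsto (fun n => (perturbed A G ℓ l (e n) v - k v) / e n) atTop
      (𝓝 (-(l u * T (-ℓ u)))) := by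
  obtain ⟨huG, hueq⟩ := hp.gradient_mem hA hK hu
  set B := T (N (k 0) + M) * M with hB
  -- The tolerance `e n ^ 2` still tends to zero after division by `e n`.
  choose y hy hlt using fun n : ℕ => exists_lt_envelope (c := fun y => A (-(ℓ y + e n * l y)))
    hp.nonempty v (pow_pos (he n) 2)
  have hlt' : ∀ n, perturbed A G ℓ l (e n) v - e n ^ 2 <
    inner ℝ (y n) v + A (-(ℓ (y n) + e n * l (y n))) := hlt
  have hδ : Tendsto (fun n => e n * B + e n ^ 2 + e n * B) atTop (𝓝 0) := by
    have := ((hlim.mul_const B).add (hlim.pow 2)).add (hlim.mul_const B)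
    simpa using this
  obtain ⟨h1, h2, -, -⟩ := hp.tendsto hA hK hu hy hδ fun n => by
    obtain ⟨a1, -, a3, -⟩ := hp.perturb_le hA hM (he n).le (he1 n) (hy n)
    have a4 := (abs_le.1 (hp.abs_perturbed_sub_le hA hM (he n).le (he1 n) v)).1
    have a5 := (abs_le.1 a3).1
    have a6 := hlt' n
    have a7 := mul_le_mul_of_nonneg_left a5 (he n).le
    linarith
  have h3 : Tendsto (fun n => e n - T (-(ℓ (y n) + e n * l (y n))) * l (y n)) atTop
      (𝓝 (-(l u * T (-ℓ u)))) := by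
    have hly : Tendsto (fun n => l (y n)) atTop (𝓝 (l u)) := (hl.tendsto u).comp h1
    have hs : Tendsto (fun n => -(ℓ (y n) + e n * l (y n))) atTop (𝓝 (-ℓ u)) := by
      have := (h2.add (hlim.mul hly)).neg
      simpa using this
    have := hlim.sub (((hA.cont.tendsto _).comp hs).mul hly)
    simpa [mul_comm] using this
  refine tendsto_of_tendsto_of_tendsto_of_le_of_le tendsto_const_nhds h3 (fun n => ?_) fun n => ?_
  · obtain ⟨-, a2, -, -⟩ := hp.perturb_le hA hM (he n).le (he1 n) huG
    have h0 : inner ℝ u v + A (-(ℓ u + e n * l u)) ≤ perturbed A G ℓ l (e n) v :=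
      le_envelope (k := fun v => k v + e n * (T (N (k 0) + M) * M))
        (hp.perturbed_aux hA hM (he n).le (he1 n)) huG v
    show _ ≤ (perturbed A G ℓ l (e n) v - k v) / e n
    rw [le_div_iff₀ (he n)]
    linarith
  · obtain ⟨a1, -, -, -⟩ := hp.perturb_le hA hM (he n).le (he1 n) (hy n)
    have a2 := hp.le _ (hy n) v
    have a6 := hlt' n
    show (perturbed A G ℓ l (e n) v - k v) / e n ≤ _
    rw [div_le_iff₀ (he n)]
    nlinarith

end Envelope

/-! ### Optimality conditions of the dual problem -/

section Optimality

variable {d : ℕ}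

/-- The convex conjugate of a real function on `ℝ^d`. -/
noncomputable def conjugate (k : Vec d → ℝ) (y : Vec d) : EReal :=
  ⨆ v : Vec d, ((inner ℝ y v - k v : ℝ) : EReal)

theorem measurable_conjugate (k : Vec d → ℝ) : Measurable (conjugate k) := by
  refine (lowerSemicontinuous_iSup fun v => Continuous.lowerSemicontinuous ?_).measurable
  exact continuous_coe_real_ereal.comp (by fun_prop)

theorem inner_sub_le_conjugate {k : Vec d → ℝ} {y : Vec d} (hy : conjugate k y < ⊤) (v : Vec d) :
    inner ℝ y v - k v ≤ (conjugate k y).toReal := by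
  have h1 : ((inner ℝ y v - k v : ℝ) : EReal) ≤ conjugate k y := le_iSup (fun v : Vec d =>
    ((inner ℝ y v - k v : ℝ) : EReal)) v
  have hbot : conjugate k y ≠ ⊥ := ((EReal.bot_lt_coe _).trans_le h1).ne'
  rwa [← EReal.coe_toReal hy.ne hbot, EReal.coe_le_coe_iff] at h1

theorem conjugate_le {k : Vec d → ℝ} {y : Vec d} {c : ℝ} (hc : ∀ v, inner ℝ y v - k v ≤ c) :
    conjugate k y < ⊤ ∧ (conjugate k y).toReal ≤ c := by
  have h1 : conjugate k y ≤ c := iSup_le fun v => EReal.coe_le_coe_iff.2 (hc v)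
  have h2 : ((inner ℝ y 0 - k 0 : ℝ) : EReal) ≤ conjugate k y := le_iSup (fun v : Vec d =>
    ((inner ℝ y v - k v : ℝ) : EReal)) 0
  have hbot : conjugate k y ≠ ⊥ := ((EReal.bot_lt_coe _).trans_le h2).ne'
  have htop : conjugate k y < ⊤ := h1.trans_lt (EReal.coe_lt_top c)
  refine ⟨htop, ?_⟩
  rwa [← EReal.coe_toReal htop.ne hbot, EReal.coe_le_coe_iff] at h1

variable {E : Type*} [NormedAddCommGroup E] [NormedSpace ℝ E]
  {H T A N : ℝ → ℝ} {f : Mat d → ℝ} {R : NNReal} {μ ν : Measure (Vec d)} {F : Vec d → Vec d}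
  {J : E →L[ℝ] Lp (Mat d) 1 μ} {D : E →L[ℝ] Lp (Vec d) 1 μ} {K G : Set (Vec d)}
  {k ℓ : Vec d → ℝ} {w : E} {h : Vec d → ℝ}

theorem IsFeasible.le_apply (hfe : IsFeasible H f R μ ν J k ℓ w h)
    (hA : IsLegendreTriple H T A N) :
    ∀ᵐ y ∂ν, ∀ v : Vec d, inner ℝ y v + A (-ℓ y) ≤ k v := by
  filter_upwards [hfe.le_left] with y hy v
  have := hA.le_of_forall (s := -ℓ y) (a := k v - inner ℝ y v) fun t ht => by
    have := hy v t ht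
    nlinarith
  linarith

/-- Every competitor can be improved to one whose potentials are conjugate to each other. -/
theorem IsFeasible.exists_conjugatePair [IsFiniteMeasure μ] [IsFiniteMeasure ν] [NeZero ν]
    (hfe : IsFeasible H f R μ ν J k ℓ w h) (hA : IsLegendreTriple H T A N) (hF : Integrable F μ)
    (hνK : ∀ᵐ y ∂ν, y ∈ K) (hKR : ∀ y ∈ K, ‖y‖ ≤ R) :
    ∃ (G : Set (Vec d)) (k' ℓ' : Vec d → ℝ), IsFeasible H f R μ ν J k' ℓ' w h ∧
      IsConjugatePair A K G k' ℓ' ∧ (∀ᵐ y ∂ν, y ∈ G) ∧ Measurable ℓ' ∧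
      dualValue F ν D k' ℓ' w h ≤ dualValue F ν D k ℓ w h := by
  set G : Set (Vec d) := {y | y ∈ K ∧ conjugate k y < ⊤} with hG
  -- This solves `A (-ℓ' y) = -k^*(y)` and is the least `ℓ` admissible for `k`. Afterwards `k` is
  -- lowered to the envelope of its affine minorants with slope in `K`.
  set ℓ' : Vec d → ℝ := fun y => -N (-(conjugate k y).toReal) with hℓ'
  have hAℓ' : ∀ y, A (-ℓ' y) = -(conjugate k y).toReal := fun y => by
    simp only [hℓ', neg_neg, hA.apply_inv]
  have hνG : ∀ᵐ y ∂ν, y ∈ G ∧ ℓ' y ≤ ℓ y := by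
    filter_upwards [hνK, hfe.le_apply hA] with y hyK hy
    obtain ⟨h1, h2⟩ := conjugate_le (k := k) (y := y) (c := -A (-ℓ y)) fun v => by linarith [hy v]
    refine ⟨⟨hyK, h1⟩, ?_⟩
    have := hA.inv_mono (show A (-ℓ y) ≤ -(conjugate k y).toReal by linarith)
    rw [hA.inv_apply] at this
    simp only [hℓ']
    linarith
  have hGne : G.Nonempty := by
    obtain ⟨y, hy⟩ := hνG.exists
    exact ⟨y, hy.1⟩
  have hle : ∀ y ∈ G, ∀ v, inner ℝ y v + A (-ℓ' y) ≤ k v := fun y hy v => by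
    rw [hAℓ']
    linarith [inner_sub_le_conjugate hy.2 v]
  have hlip : LipschitzWith R (envelope G fun y => A (-ℓ' y)) :=
    lipschitzWith_envelope hGne (fun y hy => hKR y hy.1) hle
  have hmeas : Measurable ℓ' :=
    (hA.cont_inv.measurable.comp (measurable_conjugate k).ereal_toReal.neg).neg
  have hlow : ∀ᵐ y ∂ν, -N (k 0) ≤ ℓ' y := by
    filter_upwards [hνG] with y hy
    have := hA.inv_mono (by simpa using hle y hy.1 0 : A (-ℓ' y) ≤ k 0)
    rw [hA.inv_apply] at this
    linarith
  have hint : Integrable ℓ' ν := by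
    refine Integrable.mono' (hfe.integrable_left.norm.add (integrable_const |N (k 0)|))
      hmeas.aestronglyMeasurable ?_
    filter_upwards [hνG, hlow] with y hy hy'
    rw [Real.norm_eq_abs, Pi.add_apply, Real.norm_eq_abs, abs_le]
    have h1 := neg_abs_le (N (k 0))
    have h2 := le_abs_self (N (k 0))
    have h3 := le_abs_self (ℓ y)
    have h4 := abs_nonneg (ℓ y)
    have h5 := hy.2
    constructor <;> linarith
  refine ⟨G, envelope G fun y => A (-ℓ' y), ℓ', ⟨hlip, hint, hfe.integrable_right, ?_,
    hfe.le_right⟩, ⟨hGne, fun y hy => hy.1, fun y hy v => le_envelope hle hy v,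
      fun v δ hδ => exists_lt_envelope hGne v hδ, fun y hy c hc => ?_⟩,
      hνG.mono fun y hy => hy.1, hmeas, ?_⟩
  · filter_upwards [hνG] with y hy v t ht
    have h1 := le_envelope hle hy.1 v
    have h2 := hA.fenchel (-ℓ' y) t ht
    linarith
  · obtain ⟨h1, h2⟩ := conjugate_le (k := k) (y := y) (c := -c) fun v => by
      have := hc v
      have := envelope_le hGne hle v
      linarith
    refine ⟨⟨hy, h1⟩, ?_⟩
    rw [hAℓ']
    linarith
  · unfold dualValue
    have hi : Integrable (fun x => F x + D w x) μ := hF.add (L1.integrable_coeFn (D w))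
    gcongr ?_ + _ + ?_
    · exact integral_mono (integrable_comp_of_lipschitz hlip hi)
        (integrable_comp_of_lipschitz hfe.lipschitz hi) fun x => envelope_le hGne hle _
    · exact integral_mono_ae hint hfe.integrable_left (hνG.mono fun y hy => hy.2)

/-- A minimizer of the dual problem. -/
def IsDualMinimizer (H : ℝ → ℝ) (f : Mat d → ℝ) (R : NNReal) (μ ν : Measure (Vec d))
    (F : Vec d → Vec d) (J : E →L[ℝ] Lp (Mat d) 1 μ) (D : E →L[ℝ] Lp (Vec d) 1 μ)
    (k ℓ : Vec d → ℝ) (w : E) (h : Vec d → ℝ) : Prop :=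
  IsFeasible H f R μ ν J k ℓ w h ∧
    ∀ (k' ℓ' : Vec d → ℝ) (w' : E) (h' : Vec d → ℝ), IsFeasible H f R μ ν J k' ℓ' w' h' →
      dualValue F ν D k ℓ w h ≤ dualValue F ν D k' ℓ' w' h'

/-- Perturbing `ℓ` in a minimizer of the dual problem. -/
theorem IsDualMinimizer.integral_le [IsFiniteMeasure μ] [IsFiniteMeasure ν]
    (hmin : IsDualMinimizer H f R μ ν F J D k ℓ w h) (hA : IsLegendreTriple H T A N)
    (hF : Integrable F μ) (hp : IsConjugatePair A K G k ℓ) (hνG : ∀ᵐ y ∂ν, y ∈ G)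
    (hK : IsClosed K) (hKR : ∀ y ∈ K, ‖y‖ ≤ R) {u : Vec d → Vec d}
    (hu : ∀ᵐ x ∂μ, HasGradientAt k (u x) (F x + D w x)) {l : Vec d → ℝ} (hl : Continuous l)
    {M : ℝ} (hM : ∀ y, |l y| ≤ M) :
    ∫ x, l (u x) * T (-ℓ (u x)) ∂μ ≤ ∫ y, l y ∂ν := by
  have hli : Integrable l ν := Integrable.mono' (integrable_const M) hl.aestronglyMeasurable
    (ae_of_all _ hM)
  have hi : Integrable (fun x => F x + D w x) μ := hF.add (L1.integrable_coeFn (D w))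
  set e : ℕ → ℝ := fun n => 1 / ((n : ℝ) + 1) with he
  have he0 : ∀ n, 0 < e n := fun n => by positivity
  have he1 : ∀ n, e n ≤ 1 := fun n => by
    rw [he]
    exact div_le_one_of_le₀ (by linarith [n.cast_nonneg (α := ℝ)]) (by positivity)
  have helim : Tendsto e atTop (𝓝 0) := tendsto_one_div_add_atTop_nhds_zero_nat
  have hlip : ∀ n, LipschitzWith R (perturbed A G ℓ l (e n)) := fun n =>
    lipschitzWith_envelope (k := fun v => k v + e n * (T (N (k 0) + M) * M)) hp.nonempty
      (fun y hy => hKR y (hp.subset hy)) (hp.perturbed_aux hA hM (he0 n).le (he1 n))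
  have hfe : ∀ n, IsFeasible H f R μ ν J (perturbed A G ℓ l (e n)) (fun y => ℓ y + e n * l y) w h :=
    fun n => by
    refine ⟨hlip n, hmin.1.integrable_left.add (hli.const_mul _), hmin.1.integrable_right, ?_,
      hmin.1.le_right⟩
    filter_upwards [hνG] with y hy v t ht
    have h0 : inner ℝ y v + A (-(ℓ y + e n * l y)) ≤ perturbed A G ℓ l (e n) v :=
      le_envelope (k := fun v => k v + e n * (T (N (k 0) + M) * M))
        (hp.perturbed_aux hA hM (he0 n).le (he1 n)) hy v
    have h2 := hA.fenchel (-(ℓ y + e n * l y)) t ht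
    linarith
  have hk_int := integrable_comp_of_lipschitz hmin.1.lipschitz hi
  have hkn_int := fun n => integrable_comp_of_lipschitz (hlip n) hi
  have hq : ∀ n, 0 ≤ ∫ x, (perturbed A G ℓ l (e n) (F x + D w x) - k (F x + D w x)) / e n ∂μ +
      ∫ y, l y ∂ν := fun n => by
    have h1 := hmin.2 _ _ _ _ (hfe n)
    unfold dualValue at h1
    rw [integral_add hmin.1.integrable_left (hli.const_mul _), integral_const_mul] at h1
    rw [integral_div, integral_sub (hkn_int n) hk_int, ← sub_neg_eq_add, sub_nonneg,
      le_div_iff₀ (he0 n)]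
    linarith
  have hlim : Tendsto (fun n => ∫ x, (perturbed A G ℓ l (e n) (F x + D w x) -
      k (F x + D w x)) / e n ∂μ) atTop (𝓝 (∫ x, -(l (u x) * T (-ℓ (u x))) ∂μ)) := by
    refine tendsto_integral_of_dominated_convergence (fun _ => T (N (k 0) + M) * M)
      (fun n => (((hkn_int n).sub hk_int).div_const _).aestronglyMeasurable)
      (integrable_const _) (fun n => ae_of_all _ fun x => ?_) ?_
    · rw [Real.norm_eq_abs, abs_div, abs_of_pos (he0 n), div_le_iff₀ (he0 n), mul_comm]
      exact hp.abs_perturbed_sub_le hA hM (he0 n).le (he1 n) _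
    · filter_upwards [hu] with x hx
      exact hp.tendsto_perturbed hA hK hl hM hx he0 he1 helim
  have := ge_of_tendsto' (hlim.add_const (∫ y, l y ∂ν)) hq
  rw [integral_neg] at this
  linarith

/-- The push-forward identity satisfied by the gradient of the potential. -/
theorem IsDualMinimizer.integral_eq [IsFiniteMeasure μ] [IsFiniteMeasure ν]
    (hmin : IsDualMinimizer H f R μ ν F J D k ℓ w h) (hA : IsLegendreTriple H T A N)
    (hF : Integrable F μ) (hp : IsConjugatePair A K G k ℓ) (hνG : ∀ᵐ y ∂ν, y ∈ G)
    (hK : IsClosed K) (hKR : ∀ y ∈ K, ‖y‖ ≤ R) {u : Vec d → Vec d}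
    (hu : ∀ᵐ x ∂μ, HasGradientAt k (u x) (F x + D w x)) {l : Vec d → ℝ} (hl : Continuous l)
    {M : ℝ} (hM : ∀ y, |l y| ≤ M) :
    ∫ x, l (u x) * T (-ℓ (u x)) ∂μ = ∫ y, l y ∂ν := by
  refine le_antisymm (hmin.integral_le hA hF hp hνG hK hKR hu hl hM) ?_
  -- Only positive multiples of `l` were used as perturbations; `-l` gives the opposite inequality.
  have := hmin.integral_le hA hF hp hνG hK hKR hu hl.neg (M := M) (by simpa using hM)
  simp only [Pi.neg_apply, neg_mul, integral_neg] at this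
  linarith

/-- Perturbing `w` in a minimizer of the dual problem. -/
theorem IsDualMinimizer.variation [IsFiniteMeasure μ]
    (hmin : IsDualMinimizer H f R μ ν F J D k ℓ w h) (hF : Integrable F μ) {u : Vec d → Vec d}
    (hu : ∀ᵐ x ∂μ, HasGradientAt k (u x) (F x + D w x)) {w' : E} {h' : Vec d → ℝ}
    (hh' : Integrable h' μ) (hle : ∀ᵐ x ∂μ, ∀ ξ : Mat d, inner ℝ ξ (J w' x) - f ξ ≤ h' x) :
    ∫ x, h x ∂μ ≤ ∫ x, inner ℝ (u x) (D (w' - w) x) ∂μ + ∫ x, h' x ∂μ := by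
  have hh := hmin.1.integrable_right
  have hi : ∀ w, Integrable (fun x => F x + D w x) μ := fun w =>
    hF.add (L1.integrable_coeFn (D w))
  set c : ℕ → ℝ := fun n => (n : ℝ) + 1 with hc
  have hc0 : ∀ n, 0 < c n := fun n => by positivity
  have hc1 : ∀ n, (c n)⁻¹ ≤ 1 := fun n =>
    inv_le_one_of_one_le₀ (by simp [hc])
  -- The constraint on `(w, h)` is affine for each `ξ`, so the segment towards `(w', h')` stays
  -- feasible with the same `k` and `ℓ`.
  have hfe : ∀ n, IsFeasible H f R μ ν J k ℓ (w + (c n)⁻¹ • (w' - w))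
      (fun x => h x + (c n)⁻¹ * (h' x - h x)) := fun n => by
    refine ⟨hmin.1.lipschitz, hmin.1.integrable_left, hh.add ((hh'.sub hh).const_mul _),
      hmin.1.le_left, ?_⟩
    rw [map_add, map_smul, map_sub]
    filter_upwards [Lp.coeFn_add (J w) ((c n)⁻¹ • (J w' - J w)),
      Lp.coeFn_smul (c n)⁻¹ (J w' - J w), Lp.coeFn_sub (J w') (J w), hle, hmin.1.le_right]
      with x h1 h2 h3 h4 h5 ξ
    rw [h1, Pi.add_apply, h2, Pi.smul_apply, h3, Pi.sub_apply, inner_add_right, inner_smul_right,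
      inner_sub_right]
    have h6 := h4 ξ
    have h7 := h5 ξ
    have h8 := (inv_pos.2 (hc0 n)).le
    have h9 := mul_le_mul_of_nonneg_left h6 h8
    have h10 := mul_le_mul_of_nonneg_left h7 (sub_nonneg.2 (hc1 n))
    linarith
  have hk_int := integrable_comp_of_lipschitz hmin.1.lipschitz (hi w)
  have hDi := L1.integrable_coeFn (D (w' - w))
  have hGi : ∀ n, Integrable (fun x => F x + D w x + (c n)⁻¹ • D (w' - w) x) μ := fun n =>
    (hi w).add (hDi.smul (c n)⁻¹)
  have hq : ∀ n, 0 ≤ ∫ x, c n • (k (F x + D w x + (c n)⁻¹ • D (w' - w) x) - k (F x + D w x)) ∂μ +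
      (∫ x, h' x ∂μ - ∫ x, h x ∂μ) := fun n => by
    have h1 := hmin.2 _ _ _ _ (hfe n)
    unfold dualValue at h1
    have h3 : ∫ x, (h x + (c n)⁻¹ * (h' x - h x)) ∂μ =
        ∫ x, h x ∂μ + (c n)⁻¹ * (∫ x, h' x ∂μ - ∫ x, h x ∂μ) := by
      have hs : Integrable (fun x => h' x - h x) μ := hh'.sub hh
      rw [integral_add hh (hs.const_mul _), integral_const_mul, integral_sub hh' hh]
    rw [h3] at h1
    have h2 : ∫ x, k (F x + D (w + (c n)⁻¹ • (w' - w)) x) ∂μ =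
        ∫ x, k (F x + D w x + (c n)⁻¹ • D (w' - w) x) ∂μ := by
      rw [map_add, map_smul]
      refine integral_congr_ae ?_
      filter_upwards [Lp.coeFn_add (D w) ((c n)⁻¹ • D (w' - w)),
        Lp.coeFn_smul (c n)⁻¹ (D (w' - w))] with x h1 h2
      rw [h1, Pi.add_apply, h2, Pi.smul_apply, add_assoc]
    rw [integral_smul, integral_sub (integrable_comp_of_lipschitz hmin.1.lipschitz (hGi n)) hk_int,
      smul_eq_mul, ← h2]
    set X := ∫ x, k (F x + D (w + (c n)⁻¹ • (w' - w)) x) ∂μ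
    set Y := ∫ x, h' x ∂μ - ∫ x, h x ∂μ
    have h3 : 0 ≤ (X - ∫ x, k (F x + D w x) ∂μ) + (c n)⁻¹ * Y := by linarith
    have h4 := mul_nonneg (hc0 n).le h3
    rwa [mul_add, mul_inv_cancel_left₀ (hc0 n).ne'] at h4
  have hlim : Tendsto (fun n => ∫ x, c n • (k (F x + D w x + (c n)⁻¹ • D (w' - w) x) -
      k (F x + D w x)) ∂μ) atTop (𝓝 (∫ x, inner ℝ (u x) (D (w' - w) x) ∂μ)) := by
    refine tendsto_integral_of_dominated_convergence (fun x => R * ‖D (w' - w) x‖)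
      (fun n => (((integrable_comp_of_lipschitz hmin.1.lipschitz (hGi n)).sub hk_int).smul
        (c n)).aestronglyMeasurable)
      (hDi.norm.const_mul _) (fun n => ae_of_all _ fun x => ?_) ?_
    · have h1 := hmin.1.lipschitz.dist_le_mul (F x + D w x + (c n)⁻¹ • D (w' - w) x) (F x + D w x)
      rw [Real.dist_eq, dist_eq_norm, add_sub_cancel_left, norm_smul, norm_inv,
        Real.norm_of_nonneg (hc0 n).le] at h1
      rw [norm_smul, Real.norm_of_nonneg (hc0 n).le, Real.norm_eq_abs]
      calc _ ≤ c n * (R * ((c n)⁻¹ * ‖D (w' - w) x‖)) := by gcongr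
        _ = _ := by rw [mul_left_comm, mul_inv_cancel_left₀ (hc0 n).ne']
    · filter_upwards [hu] with x hx
      have h1 : Tendsto (fun n => ‖c n‖) atTop atTop := by
        refine tendsto_norm_atTop_atTop.comp ?_
        exact tendsto_atTop_add_const_right _ _ tendsto_natCast_atTop_atTop
      simpa using hx.hasFDerivAt.lim (D (w' - w) x) h1
  have := ge_of_tendsto' (hlim.add_const _) hq
  linarith

end Optimality

/-! ### Extended integrals -/

section EIntegral

variable {α : Type*} [MeasurableSpace α] {μ : Measure α}

theorem eintegral_congr {g₁ g₂ : α → EReal} (hg : g₁ =ᵐ[μ] g₂) :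
    eintegral μ g₁ = eintegral μ g₂ := by
  unfold eintegral
  rw [lintegral_congr_ae (hg.mono fun x hx => by simp only [hx] :
      (fun x => (g₁ x).toENNReal) =ᵐ[μ] fun x => (g₂ x).toENNReal),
    lintegral_congr_ae (hg.mono fun x hx => by simp only [hx] :
      (fun x => (-g₁ x).toENNReal) =ᵐ[μ] fun x => (-g₂ x).toENNReal)]

theorem eintegral_mono {g₁ g₂ : α → EReal} (hg : g₁ ≤ᵐ[μ] g₂) :
    eintegral μ g₁ ≤ eintegral μ g₂ := by
  refine EReal.sub_le_sub ?_ ?_ <;> rw [EReal.coe_ennreal_le_coe_ennreal_iff] <;>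
    refine lintegral_mono_ae (hg.mono fun x hx => EReal.toENNReal_le_toENNReal ?_)
  · exact hx
  · exact EReal.neg_le_neg_iff.2 hx

theorem eintegral_coe {g : α → ℝ} (hg : Integrable g μ) :
    eintegral μ (fun x => (g x : EReal)) = ((∫ x, g x ∂μ : ℝ) : EReal) := by
  have h1 : ∫⁻ x, ENNReal.ofReal (g x) ∂μ ≠ ⊤ :=
    ((lintegral_mono fun x => Real.ofReal_le_enorm (g x)).trans_lt hg.2).ne
  have h2 : ∫⁻ x, ENNReal.ofReal (-g x) ∂μ ≠ ⊤ :=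
    ((lintegral_mono fun x => (Real.ofReal_le_enorm (-g x)).trans (enorm_neg _).le).trans_lt
      hg.2).ne
  have h3 : ∀ x, (-(g x : EReal)).toENNReal = ENNReal.ofReal (-g x) := fun x => by
    rw [← EReal.coe_neg, EReal.real_coe_toENNReal]
  unfold eintegral
  simp only [EReal.real_coe_toENNReal, h3]
  rw [integral_eq_lintegral_pos_part_sub_lintegral_neg_part hg, EReal.coe_sub,
    EReal.coe_ennreal_toReal h1, EReal.coe_ennreal_toReal h2]

theorem exists_integrable_of_eintegral {g : α → EReal} (hg : AEMeasurable g μ)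
    (hpos : ∫⁻ x, (g x).toENNReal ∂μ ≠ ⊤) (hneg : ∫⁻ x, (-g x).toENNReal ∂μ ≠ ⊤) :
    ∃ r : α → ℝ, Integrable r μ ∧ g =ᵐ[μ] fun x => (r x : EReal) := by
  have h1 := ae_lt_top' hg.ereal_toENNReal hpos
  have h2 := ae_lt_top' hg.neg.ereal_toENNReal hneg
  have hr : g =ᵐ[μ] fun x => ((g x).toReal : EReal) := by
    filter_upwards [h1, h2] with x hx1 hx2
    rw [EReal.coe_toReal]
    · exact EReal.toENNReal_ne_top_iff.1 hx1.ne
    · intro h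
      simp [h] at hx2
  refine ⟨fun x => (g x).toReal, ⟨hg.ereal_toReal.aestronglyMeasurable, ?_⟩, hr⟩
  refine lt_of_le_of_lt (lintegral_mono_ae (g := fun x => (g x).toENNReal + (-g x).toENNReal) ?_)
    (?_ : _ < ⊤)
  · filter_upwards [hr] with x hx
    rw [hx, EReal.toReal_coe, ← EReal.coe_neg, EReal.real_coe_toENNReal, EReal.real_coe_toENNReal]
    rcases le_total 0 (g x).toReal with h | h
    · rw [Real.enorm_of_nonneg h]
      exact le_self_add
    · rw [← enorm_neg, Real.enorm_of_nonneg (neg_nonneg.2 h)]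
      exact le_add_self
  · rw [lintegral_add_left' hg.ereal_toENNReal]
    exact ENNReal.add_lt_top.2 ⟨hpos.lt_top, hneg.lt_top⟩

theorem lintegral_toENNReal_ne_top {g : α → EReal} {c : α → ℝ} (hc : Integrable c μ)
    (hle : ∀ᵐ x ∂μ, g x ≤ c x) : ∫⁻ x, (g x).toENNReal ∂μ ≠ ⊤ := by
  refine (lt_of_le_of_lt (lintegral_mono_ae ?_) hc.2).ne
  filter_upwards [hle] with x hx
  exact (EReal.toENNReal_le_toENNReal hx).trans (Real.ofReal_le_enorm (c x))

/-- An extended real function that is bounded below by an integrable function either has integral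
`+∞` or is integrable. -/
theorem eintegral_eq_top_or {g : α → EReal} (hg : AEMeasurable g μ) {c : α → ℝ}
    (hc : Integrable c μ) (hle : ∀ᵐ x ∂μ, (c x : EReal) ≤ g x) :
    eintegral μ g = ⊤ ∨ ∃ r : α → ℝ, Integrable r μ ∧ g =ᵐ[μ] fun x => (r x : EReal) := by
  have hneg : ∫⁻ x, (-g x).toENNReal ∂μ ≠ ⊤ := by
    refine lintegral_toENNReal_ne_top hc.neg ?_
    filter_upwards [hle] with x hx
    simpa using EReal.neg_le_neg_iff.2 hx
  by_cases hpos : ∫⁻ x, (g x).toENNReal ∂μ = ⊤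
  · left
    unfold eintegral
    rw [hpos, ← EReal.coe_ennreal_toReal hneg]
    simp
  · exact Or.inr (exists_integrable_of_eintegral hg hpos hneg)

/-- An extended real function that is bounded above by an integrable function either has integral
`-∞` or is integrable. -/
theorem eintegral_eq_bot_or {g : α → EReal} (hg : AEMeasurable g μ) {c : α → ℝ}
    (hc : Integrable c μ) (hle : ∀ᵐ x ∂μ, g x ≤ c x) :
    eintegral μ g = ⊥ ∨ ∃ r : α → ℝ, Integrable r μ ∧ g =ᵐ[μ] fun x => (r x : EReal) := by
  have hpos := lintegral_toENNReal_ne_top hc hle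
  by_cases hneg : ∫⁻ x, (-g x).toENNReal ∂μ = ⊤
  · left
    unfold eintegral
    rw [hneg, ← EReal.coe_ennreal_toReal hpos]
    simp
  · exact Or.inr (exists_integrable_of_eintegral hg hpos hneg)

end EIntegral

/-! ### The two terms of the energy -/

section Energy

variable {d : ℕ}

theorem measurable_legendre (f : Mat d → ℝ) : Measurable (legendre f) := by
  refine (lowerSemicontinuous_iSup fun v => Continuous.lowerSemicontinuous ?_).measurable
  exact continuous_coe_real_ereal.comp (by fun_prop)

theorem le_legendre (f : Mat d → ℝ) (ξ y : Mat d) :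
    ((inner ℝ ξ y - f ξ : ℝ) : EReal) ≤ legendre f y :=
  le_iSup (fun x : Mat d => ((inner ℝ x y - f x : ℝ) : EReal)) ξ

theorem integrable_inner_of_bounded {μ : Measure (Vec d)} {u G : Vec d → Vec d} {R : ℝ}
    (hu : AEMeasurable u μ) (hR : ∀ᵐ x ∂μ, ‖u x‖ ≤ R) (hG : Integrable G μ) :
    Integrable (fun x => inner ℝ (u x) (G x)) μ := by
  refine Integrable.mono' (hG.norm.const_mul R)
    (hu.aestronglyMeasurable.inner hG.aestronglyMeasurable) ?_
  filter_upwards [hR] with x hx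
  refine (norm_inner_le_norm _ _).trans ?_
  gcongr

variable {q : ℝ} {Ω Λ : Set (Vec d)} {S : Submodule ℝ (LqPair d q Ω)}
  {f : Mat d → ℝ} {u : Vec d → Vec d}

theorem integral_neg_sub {α : Type*} [MeasurableSpace α] {μ : Measure α} {a h : α → ℝ}
    (ha : Integrable a μ) (hh : Integrable h μ) :
    ∫ x, (-a x - h x) ∂μ = -(∫ x, a x ∂μ) - ∫ x, h x ∂μ := by
  have hn : Integrable (fun x => -a x) μ := ha.neg
  rw [integral_sub hn hh, integral_neg]

theorem le_V {w : LqPair d q Ω} (hw : w ∈ S) {a h : Vec d → ℝ}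
    (ha : Integrable a (volume.restrict Ω)) (hh : Integrable h (volume.restrict Ω))
    (hau : ∀ᵐ x ∂volume.restrict Ω, a x = inner ℝ (u x) (divergence w x))
    (hle : ∀ᵐ x ∂volume.restrict Ω, ∀ ξ : Mat d, inner ℝ ξ (w.1 x) - f ξ ≤ h x) :
    ((-(∫ x in Ω, a x) - ∫ x in Ω, h x : ℝ) : EReal) ≤ V f (S : Set (LqPair d q Ω)) u := by
  have h1 : eintegral (volume.restrict Ω) (fun x => ((-a x - h x : ℝ) : EReal)) ≤
      V f (S : Set (LqPair d q Ω)) u := by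
    refine le_trans (eintegral_mono ?_) (le_iSup₂ (f := fun (w : LqPair d q Ω)
      (_ : w ∈ (S : Set (LqPair d q Ω))) => eintegral (volume.restrict Ω)
      (fun x => ((-inner ℝ (u x) (divergence w x) : ℝ) : EReal) - legendre f (w.1 x))) w hw)
    filter_upwards [hau, hle] with x hx hx'
    rw [EReal.coe_sub, hx]
    exact EReal.sub_le_sub le_rfl (iSup_le fun ξ => EReal.coe_le_coe_iff.2 (hx' ξ))
  have h2 : Integrable (fun x => -a x - h x) (volume.restrict Ω) := ha.neg.sub hh
  rwa [eintegral_coe h2, integral_neg_sub ha hh] at h1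

/-- It suffices to test integrable majorants of `f^*(φ)`: the integrand is bounded above, so any `φ`
for which it is not integrable contributes `-∞`. -/
theorem V_le [IsFiniteMeasure ((volume : Measure (Vec d)).restrict Ω)]
    (hu : ∀ w ∈ S, Integrable (fun x => inner ℝ (u x) (divergence w x)) (volume.restrict Ω))
    {C : ℝ} (hC : ∀ w ∈ S, ∀ h : Vec d → ℝ, Integrable h (volume.restrict Ω) →
      (∀ᵐ x ∂volume.restrict Ω, ∀ ξ : Mat d, inner ℝ ξ (w.1 x) - f ξ ≤ h x) →
      -(∫ x in Ω, inner ℝ (u x) (divergence w x)) - ∫ x in Ω, h x ≤ C) :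
    V f (S : Set (LqPair d q Ω)) u ≤ C := by
  refine iSup₂_le fun w hw => ?_
  have ha := hu w hw
  set a : Vec d → ℝ := fun x => inner ℝ (u x) (divergence w x) with ha_def
  have hmeas : AEMeasurable (fun x => ((-a x : ℝ) : EReal) - legendre f (w.1 x))
      (volume.restrict Ω) := by
    simp only [sub_eq_add_neg]
    refine ha.aestronglyMeasurable.aemeasurable.neg.coe_real_ereal.add ?_
    exact ((measurable_legendre f).comp_aemeasurable
      (Lp.aestronglyMeasurable w.1).aemeasurable).neg
  have hbound : ∀ᵐ x ∂volume.restrict Ω,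
      ((-a x : ℝ) : EReal) - legendre f (w.1 x) ≤ ((-a x + f 0 : ℝ) : EReal) := by
    refine ae_of_all _ fun x => ?_
    have h1 := le_legendre f 0 (w.1 x)
    rw [inner_zero_left, zero_sub] at h1
    refine (EReal.sub_le_sub le_rfl h1).trans (le_of_eq ?_)
    rw [← EReal.coe_sub, sub_neg_eq_add]
  rcases eintegral_eq_bot_or hmeas (ha.neg.add (integrable_const (f 0))) hbound with h | ⟨r, hr, hgr⟩
  · rw [h]
    exact bot_le
  · rw [eintegral_congr hgr, eintegral_coe hr, EReal.coe_le_coe_iff]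
    have hi : Integrable (fun x => -a x - r x) (volume.restrict Ω) := ha.neg.sub hr
    -- Here `-a - r` equals `f^*(φ)` almost everywhere, so it is the sharp majorant.
    have h1 := hC w hw (fun x => -a x - r x) hi (by
      filter_upwards [hgr] with x hx ξ
      have h2 := EReal.sub_le_sub (le_refl ((-a x : ℝ) : EReal)) (le_legendre f ξ (w.1 x))
      rw [hx, ← EReal.coe_sub, EReal.coe_le_coe_iff] at h2
      linarith)
    rw [integral_neg_sub ha hr] at h1
    change -(∫ x in Ω, a x) - _ ≤ C at h1
    linarith

end Energy

/-! ### Weak duality -/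

section WeakDuality

variable {d : ℕ} {q : ℝ} {Ω Λ : Set (Vec d)}

/-- The transport condition as an identity between measures. -/
theorem MemUStar.map_eq [IsFiniteMeasure ((volume : Measure (Vec d)).restrict Λ)]
    (hΩ : MeasurableSet Ω) (hΛ : IsCompact (closure Λ)) {S : Set (LqPair d q Ω)}
    {v : Vec d → Vec d} {γ : Vec d → ℝ} (hv : MemUStar Λ S v γ) :
    Measure.map v ((volume.restrict Ω).withDensity fun x => ENNReal.ofReal (γ x)) =
      volume.restrict Λ := by
  -- Testing the transport condition with `l = 1` on `closure Λ` shows that `γ` is integrable, so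
  -- the weighted measure is finite.
  obtain ⟨l, hl1, -, hlc, -⟩ := exists_continuous_one_zero_of_isCompact hΛ isClosed_empty
    (disjoint_empty _)
  have hγ0 : ∀ᵐ x ∂volume.restrict Ω, 0 ≤ γ x := by
    filter_upwards [ae_restrict_mem hΩ] with x hx using hv.nonneg x hx
  have hγi : Integrable γ (volume.restrict Ω) := by
    refine (hv.transport l l.continuous hlc).1.congr ?_
    filter_upwards [ae_restrict_mem hΩ] with x hx
    rw [hl1 (hv.memU.mapsTo x hx), Pi.one_apply, one_mul]
  have := isFiniteMeasure_withDensity_ofReal hγi.2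
  have hγm : AEMeasurable (fun x => ENNReal.ofReal (γ x)) (volume.restrict Ω) :=
    hv.measurable.ennreal_ofReal
  have hvm : AEMeasurable v ((volume.restrict Ω).withDensity fun x => ENNReal.ofReal (γ x)) :=
    hv.memU.measurable.mono_ac (withDensity_absolutelyContinuous _ _)
  refine Measure.ext_of_integral_eq_on_compactlySupported fun g => ?_
  rw [integral_map hvm (map_continuous g).aestronglyMeasurable,
    integral_withDensity_eq_integral_toReal_smul₀ hγm (ae_of_all _ fun _ => ENNReal.ofReal_lt_top)]
  rw [← (hv.transport g g.continuous g.hasCompactSupport).2]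
  refine integral_congr_ae ?_
  filter_upwards [hγ0] with x hx
  rw [ENNReal.toReal_ofReal hx, smul_eq_mul, mul_comm]

/-- The definition tests only with continuous functions, whereas the dual potential is merely
integrable; the identity of measures covers it. -/
theorem MemUStar.integral_eq [IsFiniteMeasure ((volume : Measure (Vec d)).restrict Λ)]
    (hΩ : MeasurableSet Ω) (hΛ : IsCompact (closure Λ)) {S : Set (LqPair d q Ω)}
    {v : Vec d → Vec d} {γ : Vec d → ℝ} (hv : MemUStar Λ S v γ) {ℓ : Vec d → ℝ}
    (hℓ : Integrable ℓ (volume.restrict Λ)) :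
    Integrable (fun x => γ x * ℓ (v x)) (volume.restrict Ω) ∧
      ∫ x in Ω, γ x * ℓ (v x) = ∫ y in Λ, ℓ y := by
  have hmap := hv.map_eq hΩ hΛ
  have hγm : AEMeasurable (fun x => ENNReal.ofReal (γ x)) (volume.restrict Ω) :=
    hv.measurable.ennreal_ofReal
  have hvm : AEMeasurable v ((volume.restrict Ω).withDensity fun x => ENNReal.ofReal (γ x)) :=
    hv.memU.measurable.mono_ac (withDensity_absolutelyContinuous _ _)
  have hcongr : (fun x => (ENNReal.ofReal (γ x)).toReal • ℓ (v x)) =ᵐ[volume.restrict Ω]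
      fun x => γ x * ℓ (v x) := by
    filter_upwards [ae_restrict_mem hΩ] with x hx
    rw [ENNReal.toReal_ofReal (hv.nonneg x hx), smul_eq_mul]
  rw [← hmap] at hℓ
  constructor
  · rw [integrable_map_measure hℓ.aestronglyMeasurable hvm,
      integrable_withDensity_iff_integrable_smul₀' hγm
        (ae_of_all _ fun _ => ENNReal.ofReal_lt_top)] at hℓ
    exact hℓ.congr hcongr
  · rw [← integral_congr_ae hcongr,
      ← integral_withDensity_eq_integral_toReal_smul₀ hγm
        (ae_of_all _ fun _ => ENNReal.ofReal_lt_top) (fun x => ℓ (v x)),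
      ← integral_map hvm hℓ.aestronglyMeasurable, hmap]

theorem MemUStar.ae_of_ae [IsFiniteMeasure ((volume : Measure (Vec d)).restrict Λ)]
    (hΩ : MeasurableSet Ω) (hΛ : IsCompact (closure Λ)) {S : Set (LqPair d q Ω)}
    {v : Vec d → Vec d} {γ : Vec d → ℝ} (hv : MemUStar Λ S v γ) {P : Vec d → Prop}
    (hP : ∀ᵐ y ∂volume.restrict Λ, P y) : ∀ᵐ x ∂volume.restrict Ω, 0 < γ x → P (v x) := by
  have hγm : AEMeasurable (fun x => ENNReal.ofReal (γ x)) (volume.restrict Ω) :=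
    hv.measurable.ennreal_ofReal
  have hvm : AEMeasurable v ((volume.restrict Ω).withDensity fun x => ENNReal.ofReal (γ x)) :=
    hv.memU.measurable.mono_ac (withDensity_absolutelyContinuous _ _)
  rw [← hv.map_eq hΩ hΛ] at hP
  have h1 := ae_of_ae_map hvm hP
  rw [ae_withDensity_iff' hγm] at h1
  filter_upwards [h1] with x hx hpos
  exact hx (by simpa using hpos)

theorem measurable_extendH {H : ℝ → ℝ} (hH : AssumptionA2 H) : Measurable (extendH H) := by
  classical
  have h1 : extendH H = (Ioi (0 : ℝ)).piecewise (fun t => (H t : EReal)) fun _ => ⊤ := by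
    funext t
    by_cases ht : 0 < t <;> simp [extendH, ht]
  rw [h1]
  exact ContinuousOn.measurable_piecewise
    (continuous_coe_real_ereal.comp_continuousOn hH.contDiff.continuousOn) continuousOn_const
    measurableSet_Ioi

variable {H T A N : ℝ → ℝ} {F v : Vec d → Vec d} {γ : Vec d → ℝ} {R : ℝ}

/-- The bound `H ≥ -A 0` excludes `-∞`. If the integral is not `+∞`, the integrand is finite almost
everywhere, which forces `γ > 0` because the extended `H` is infinite at `0`. -/
theorem eintegral_energy (hH : AssumptionA2 H) (hA : IsLegendreTriple H T A N)
    {μ : Measure (Vec d)} [IsFiniteMeasure μ] (hF : Integrable F μ) (hv : AEMeasurable v μ)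
    (hR : ∀ᵐ x ∂μ, ‖v x‖ ≤ R) (hγ : AEMeasurable γ μ) :
    eintegral μ (fun x => extendH H (γ x) - ((inner ℝ (F x) (v x) : ℝ) : EReal)) = ⊤ ∨
    ∃ r : Vec d → ℝ, Integrable r μ ∧
      (∀ᵐ x ∂μ, 0 < γ x ∧ r x = H (γ x) - inner ℝ (F x) (v x)) ∧
      eintegral μ (fun x => extendH H (γ x) - ((inner ℝ (F x) (v x) : ℝ) : EReal)) =
        ((∫ x, r x ∂μ : ℝ) : EReal) := by
  have hFv : Integrable (fun x => inner ℝ (F x) (v x)) μ := by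
    simpa only [real_inner_comm] using integrable_inner_of_bounded hv hR hF
  have hmeas : AEMeasurable (fun x => extendH H (γ x) - ((inner ℝ (F x) (v x) : ℝ) : EReal)) μ := by
    simp only [sub_eq_add_neg]
    exact ((measurable_extendH hH).comp_aemeasurable hγ).add
      hFv.aestronglyMeasurable.aemeasurable.coe_real_ereal.neg
  have hbound : ∀ᵐ x ∂μ, ((-A 0 - inner ℝ (F x) (v x) : ℝ) : EReal) ≤
      extendH H (γ x) - ((inner ℝ (F x) (v x) : ℝ) : EReal) := by
    refine ae_of_all _ fun x => ?_
    rw [EReal.coe_sub]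
    refine EReal.sub_le_sub ?_ le_rfl
    unfold extendH
    split_ifs with h
    · rw [EReal.coe_le_coe_iff]
      have := hA.fenchel 0 (γ x) h
      linarith
    · exact le_top
  rcases eintegral_eq_top_or hmeas ((integrable_const (-A 0)).sub hFv) hbound with h | ⟨r, hr, hgr⟩
  · exact Or.inl h
  · refine Or.inr ⟨r, hr, ?_, by rw [eintegral_congr hgr, eintegral_coe hr]⟩
    filter_upwards [hgr] with x hx
    unfold extendH at hx
    split_ifs at hx with h
    · rw [← EReal.coe_sub, EReal.coe_eq_coe_iff] at hx
      exact ⟨h, hx.symm⟩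
    · simp at hx

variable {S : Submodule ℝ (LqPair d q Ω)} {f : Mat d → ℝ}
  {E : Type*} [NormedAddCommGroup E] [NormedSpace ℝ E] {ι : E → LqPair d q Ω}
  {J : E →L[ℝ] Lp (Mat d) 1 (volume.restrict Ω)} {D : E →L[ℝ] Lp (Vec d) 1 (volume.restrict Ω)}
  {K G : Set (Vec d)} {k ℓ h : Vec d → ℝ} {w : E}

/-- Weak duality, with the duality gap written as an integral. -/
theorem exists_duality_gap [IsFiniteMeasure ((volume : Measure (Vec d)).restrict Ω)]
    [IsFiniteMeasure ((volume : Measure (Vec d)).restrict Λ)] {R : NNReal}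
    (hH : AssumptionA2 H) (hA : IsLegendreTriple H T A N) (hΩ : MeasurableSet Ω)
    (hΛ : IsCompact (closure Λ)) (hΛR : ∀ y ∈ closure Λ, ‖y‖ ≤ R)
    (hF : Integrable F (volume.restrict Ω)) (hι : ∀ w, ι w ∈ S)
    (hJ : ∀ w, J w =ᵐ[volume.restrict Ω] (ι w).1)
    (hD : ∀ w, D w =ᵐ[volume.restrict Ω] divergence (ι w))
    (hfe : IsFeasible H f R (volume.restrict Ω) (volume.restrict Λ) J k ℓ w h)
    (hp : IsConjugatePair A K G k ℓ) (hG : ∀ᵐ y ∂volume.restrict Λ, y ∈ G)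
    (hv : MemUStar Λ (S : Set (LqPair d q Ω)) v γ) :
    energy f H F (S : Set (LqPair d q Ω)) v γ = ⊤ ∨
    ∃ g : Vec d → ℝ, Integrable g (volume.restrict Ω) ∧
      (∀ᵐ x ∂volume.restrict Ω, 0 < γ x ∧ v x ∈ G ∧ 0 ≤ g x ∧
        g x = H (γ x) + γ x * ℓ (v x) + k (F x + D w x) - inner ℝ (v x) (F x + D w x)) ∧
      ((-dualValue F (volume.restrict Λ) D k ℓ w h + ∫ x in Ω, g x : ℝ) : EReal) ≤
        energy f H F (S : Set (LqPair d q Ω)) v γ ∧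
      energy f H F (S : Set (LqPair d q Ω)) v γ =
        V f (S : Set (LqPair d q Ω)) v + ((-dualValue F (volume.restrict Λ) D k ℓ w h +
          ∫ x in Ω, g x ∂volume + (∫ x in Ω, inner ℝ (v x) (D w x) ∂volume) +
          ∫ x in Ω, h x : ℝ) : EReal) := by
  have hvR : ∀ᵐ x ∂volume.restrict Ω, ‖v x‖ ≤ R := by
    filter_upwards [ae_restrict_mem hΩ] with x hx using hΛR _ (hv.memU.mapsTo x hx)
  have hDi := L1.integrable_coeFn (D w)
  have ha : Integrable (fun x => inner ℝ (v x) (D w x)) (volume.restrict Ω) :=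
    integrable_inner_of_bounded hv.memU.measurable hvR hDi
  have hV := le_V (f := f) (u := v) (hι w) ha hfe.integrable_right
    (by filter_upwards [hD w] with x hx; rw [hx])
    (by filter_upwards [hJ w, hfe.le_right] with x hx hx'; rwa [← hx])
  rcases eintegral_energy hH hA hF hv.memU.measurable hvR hv.measurable with htop | ⟨r, hr, hrx, he⟩
  · left
    unfold energy
    rw [htop]
    exact EReal.add_top_of_ne_bot ((EReal.bot_lt_coe _).trans_le hV).ne'
  · right
    obtain ⟨hℓi, hℓe⟩ := hv.integral_eq hΩ hΛ hfe.integrable_left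
    have hki := integrable_comp_of_lipschitz hfe.lipschitz (hF.add hDi)
    simp only [Pi.add_apply] at hki
    have hgi : Integrable (fun x => r x + γ x * ℓ (v x) + k (F x + D w x) - inner ℝ (v x) (D w x))
        (volume.restrict Ω) := ((hr.add hℓi).add hki).sub ha
    have hgint : ∫ x in Ω, (r x + γ x * ℓ (v x) + k (F x + D w x) - inner ℝ (v x) (D w x)) =
        (∫ x in Ω, r x) + (∫ y in Λ, ℓ y) + (∫ x in Ω, k (F x + D w x)) -
          ∫ x in Ω, inner ℝ (v x) (D w x) := by
      have i1 : Integrable (fun x => r x + γ x * ℓ (v x)) (volume.restrict Ω) := hr.add hℓi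
      have i2 : Integrable (fun x => r x + γ x * ℓ (v x) + k (F x + D w x))
        (volume.restrict Ω) := i1.add hki
      rw [integral_sub i2 ha, integral_add i1 hki, integral_add hr hℓi, hℓe]
    have hreal : (∫ x in Ω, r x) = -dualValue F (volume.restrict Λ) D k ℓ w h +
        (∫ x in Ω, (r x + γ x * ℓ (v x) + k (F x + D w x) - inner ℝ (v x) (D w x))) +
          (∫ x in Ω, inner ℝ (v x) (D w x)) + ∫ x in Ω, h x := by
      rw [hgint]
      unfold dualValue
      ring
    refine ⟨_, hgi, ?_, ?_, ?_⟩
    · filter_upwards [hrx, hv.ae_of_ae hΩ hΛ hG] with x hx hxG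
      have hGx := hxG hx.1
      -- The gap is the sum of two slacks: in the constraint linking `k` and `ℓ`, and in the Fenchel
      -- inequality for `H` and `A`.
      have h1 := hp.le _ hGx (F x + D w x)
      have h2 := hA.fenchel (-ℓ (v x)) (γ x) hx.1
      have h3 : r x + γ x * ℓ (v x) + k (F x + D w x) - inner ℝ (v x) (D w x) =
          H (γ x) + γ x * ℓ (v x) + k (F x + D w x) - inner ℝ (v x) (F x + D w x) := by
        rw [hx.2, inner_add_right, real_inner_comm (v x) (F x)]
        ring
      refine ⟨hx.1, hGx, ?_, h3⟩
      rw [h3]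
      linarith
    · unfold energy
      rw [he]
      refine le_trans (le_of_eq ?_) (add_le_add_left hV _)
      rw [← EReal.coe_add, hreal]
      congr 1
      ring
    · unfold energy
      rw [he, hreal]

end WeakDuality

/-! ### From the dual minimizer to the primal one -/

section Primal

variable {d : ℕ} {q : ℝ} {Ω Λ : Set (Vec d)} {H T A N : ℝ → ℝ} {F : Vec d → Vec d}
  {S : Submodule ℝ (LqPair d q Ω)} {f : Mat d → ℝ}
  {E : Type*} [NormedAddCommGroup E] [NormedSpace ℝ E] {ι : E → LqPair d q Ω}
  {J : E →L[ℝ] Lp (Mat d) 1 (volume.restrict Ω)} {D : E →L[ℝ] Lp (Vec d) 1 (volume.restrict Ω)}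
  {G : Set (Vec d)} {k ℓ h : Vec d → ℝ} {w : E} {R : NNReal}

theorem abs_integral_inner_le {μ : Measure (Vec d)} {u g : Vec d → Vec d} (hg : Integrable g μ)
    (hu : ∀ᵐ x ∂μ, ‖u x‖ ≤ R) : |∫ x, inner ℝ (u x) (g x) ∂μ| ≤ R * ∫ x, ‖g x‖ ∂μ := by
  rw [← integral_const_mul, ← Real.norm_eq_abs]
  refine norm_integral_le_of_norm_le (hg.norm.const_mul _) ?_
  filter_upwards [hu] with x hx
  refine (norm_inner_le_norm _ _).trans ?_
  gcongr

theorem IsConjugatePair.exists_gradient_field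
    (hp : IsConjugatePair A (closure Λ) G k ℓ)
    (hA : IsLegendreTriple H T A N) (hF : AEMeasurable F (volume.restrict Ω))
    (h0 : (0 : Vec d) ∈ closure Λ)
    (hdiff : ∀ᵐ x ∂volume.restrict Ω, DifferentiableAt ℝ k (F x + D w x)) :
    ∃ u : Vec d → Vec d, AEMeasurable u (volume.restrict Ω) ∧ (∀ x, u x ∈ closure Λ) ∧
      ∀ᵐ x ∂volume.restrict Ω, HasGradientAt k (u x) (F x + D w x) := by
  classical
  have hgm : Measurable (gradient k) := by
    unfold gradient
    exact (InnerProductSpace.toDual ℝ (Vec d)).symm.continuous.measurable.comp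
      (measurable_fderiv ℝ k)
  have hVm : AEMeasurable (fun x => F x + D w x) (volume.restrict Ω) :=
    hF.add (Lp.aestronglyMeasurable (D w)).aemeasurable
  -- Values in `closure Λ` are required at every point, while the gradient is controlled only where
  -- `k` is differentiable; elsewhere any value outside `closure Λ` is reset to `0`.
  let c : Vec d → Vec d := (closure Λ).piecewise id fun _ => 0
  have hcm : Measurable c := Measurable.piecewise isClosed_closure.measurableSet measurable_id
    measurable_const
  have hc : ∀ y, c y ∈ closure Λ := fun y => by
    by_cases hy : y ∈ closure Λ <;> simp [c, hy, h0]
  refine ⟨fun x => c (gradient k (F x + D w x)), hcm.comp_aemeasurable (hgm.comp_aemeasurable hVm),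
    fun x => hc _, ?_⟩
  filter_upwards [hdiff] with x hx
  have hgrad := hx.hasGradientAt
  have hmem := hp.subset (hp.gradient_mem hA isClosed_closure hgrad).1
  have : c (gradient k (F x + D w x)) = gradient k (F x + D w x) := by simp [c, hmem]
  rwa [this]

set_option maxHeartbeats 1000000 in
theorem IsDualMinimizer.exists_unique_minimizer
    [IsFiniteMeasure ((volume : Measure (Vec d)).restrict Ω)]
    [IsFiniteMeasure ((volume : Measure (Vec d)).restrict Λ)]
    (hmin : IsDualMinimizer H f R (volume.restrict Ω) (volume.restrict Λ) F J D k ℓ w h)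
    (hH : AssumptionA2 H) (hA : IsLegendreTriple H T A N) (hΩ : MeasurableSet Ω)
    (hΛ : IsCompact (closure Λ)) (hΛR : ∀ y ∈ closure Λ, ‖y‖ ≤ R) (h0 : (0 : Vec d) ∈ closure Λ)
    (hF : Integrable F (volume.restrict Ω)) (hι : ∀ w, ι w ∈ S) (hιS : ∀ w ∈ S, ∃ e, ι e = w)
    (hJ : ∀ w, J w =ᵐ[volume.restrict Ω] (ι w).1)
    (hD : ∀ w, D w =ᵐ[volume.restrict Ω] divergence (ι w))
    {C : ℝ} (hC : 0 ≤ C) (hDC : ∀ w, ‖D w‖ ≤ C * ‖(ι w).1‖)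
    (hp : IsConjugatePair A (closure Λ) G k ℓ) (hG : ∀ᵐ y ∂volume.restrict Λ, y ∈ G)
    (hℓ : Measurable ℓ)
    (hdiff : ∀ᵐ x ∂volume.restrict Ω, DifferentiableAt ℝ k (F x + D w x)) :
    ∃ (u : Vec d → Vec d) (β : Vec d → ℝ),
      IsMinimizer Λ f H F (S : Set (LqPair d q Ω)) u β ∧
      ∀ (v : Vec d → Vec d) (γ : Vec d → ℝ),
        IsMinimizer Λ f H F (S : Set (LqPair d q Ω)) v γ →
        v =ᵐ[volume.restrict Ω] u ∧ γ =ᵐ[volume.restrict Ω] β := by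
  obtain ⟨u, hum, huΛ, hu⟩ := hp.exists_gradient_field hA hF.aestronglyMeasurable.aemeasurable
    h0 hdiff
  have huR : ∀ᵐ x ∂volume.restrict Ω, ‖u x‖ ≤ R := ae_of_all _ fun x => hΛR _ (huΛ x)
  have huG : ∀ᵐ x ∂volume.restrict Ω, u x ∈ G ∧
      inner ℝ (u x) (F x + D w x) + A (-ℓ (u x)) = k (F x + D w x) := by
    filter_upwards [hu] with x hx using hp.gradient_mem hA isClosed_closure hx
  have hDi := fun e => L1.integrable_coeFn (D e)
  have huD : ∀ e, Integrable (fun x => inner ℝ (u x) (D e x)) (volume.restrict Ω) := fun e =>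
    integrable_inner_of_bounded hum huR (hDi e)
  have hcongr : ∀ e, (fun x => inner ℝ (u x) (divergence (ι e) x)) =ᵐ[volume.restrict Ω]
      fun x => inner ℝ (u x) (D e x) := fun e => by
    filter_upwards [hD e] with x hx
    rw [hx]
  set β : Vec d → ℝ := fun x => T (-ℓ (u x)) with hβ
  have hβm : AEMeasurable β (volume.restrict Ω) :=
    (hA.cont.measurable.comp hℓ.neg).comp_aemeasurable hum
  have hstar : MemUStar Λ (S : Set (LqPair d q Ω)) u β := by
    -- The estimate holds with `R * C`; the `+ 1` only makes the constant positive.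
    refine ⟨⟨hum, fun x _ => huΛ x, R * C + 1, by positivity, fun w' hw' => ?_⟩, hβm,
      fun x _ => (hA.pos _).le, fun l hl hlc => ?_⟩
    · obtain ⟨e, rfl⟩ := hιS w' hw'
      rw [integral_congr_ae (hcongr e)]
      have h1 := abs_integral_inner_le (R := R) (hDi e) huR
      rw [← L1.norm_eq_integral_norm] at h1
      have h2 : (R : ℝ) * ‖D e‖ ≤ R * (C * ‖(ι e).1‖) := by gcongr; exact hDC e
      have h3 : 0 ≤ ‖(ι e).1‖ := by
        rw [Lp.norm_def]
        exact ENNReal.toReal_nonneg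
      linarith
    · obtain ⟨M, hM⟩ := hlc.exists_bound_of_continuous hl
      refine ⟨?_, hmin.integral_eq hA hF hp hG isClosed_closure hΛR hu hl hM⟩
      refine Integrable.mono' (integrable_const (M * T (N (k 0))))
        ((hl.measurable.comp_aemeasurable hum).mul hβm).aestronglyMeasurable ?_
      filter_upwards [huG] with x hx
      rw [norm_mul, Real.norm_of_nonneg (hA.pos _).le]
      exact mul_le_mul (hM _) (hA.mono (hp.neg_le hA hx.1)) (hA.pos _).le
        ((norm_nonneg _).trans (hM (u x)))
  -- The variational inequality from `w` towards each `e` says that `w` attains the supremum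
  -- defining `V(u)`.
  have hVle : V f (S : Set (LqPair d q Ω)) u ≤
      ((-(∫ x in Ω, inner ℝ (u x) (D w x)) - ∫ x in Ω, h x : ℝ) : EReal) := by
    refine V_le (fun w' hw' => ?_) fun w' hw' h' hh' hle => ?_
    · obtain ⟨e, rfl⟩ := hιS w' hw'
      exact (huD e).congr (hcongr e).symm
    · obtain ⟨e, rfl⟩ := hιS w' hw'
      rw [integral_congr_ae (hcongr e)]
      have h1 := hmin.variation hF hu (w' := e) hh' (by
        filter_upwards [hJ e, hle] with x hx hx'
        rwa [hx])
      have h2 : ∫ x in Ω, inner ℝ (u x) (D (e - w) x) =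
          (∫ x in Ω, inner ℝ (u x) (D e x)) - ∫ x in Ω, inner ℝ (u x) (D w x) := by
        rw [← integral_sub (huD e) (huD w), map_sub]
        refine integral_congr_ae ?_
        filter_upwards [Lp.coeFn_sub (D e) (D w)] with x hx
        rw [hx, Pi.sub_apply, inner_sub_right]
      rw [h2] at h1
      linarith
  have hHβ : ∀ᵐ x ∂volume.restrict Ω, H (β x) =
      inner ℝ (u x) (F x + D w x) - k (F x + D w x) - β x * ℓ (u x) := by
    filter_upwards [huG] with x hx
    have h1 := hA.eq (-ℓ (u x))
    simp only [hβ]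
    linarith [hx.2]
  -- This excludes the infinite alternative of the gap dichotomy for `(u, β)`.
  have hfin : energy f H F (S : Set (LqPair d q Ω)) u β ≠ ⊤ := by
    have hVi := hF.add (hDi w)
    have hVi' : Integrable (fun x => inner ℝ (u x) (F x + D w x)) (volume.restrict Ω) :=
      integrable_inner_of_bounded hum huR hVi
    have hi : Integrable (fun x => inner ℝ (u x) (F x + D w x) - k (F x + D w x) -
        β x * ℓ (u x) - inner ℝ (u x) (F x)) (volume.restrict Ω) :=
      ((hVi'.sub (integrable_comp_of_lipschitz hmin.1.lipschitz hVi)).sub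
        (hstar.integral_eq hΩ hΛ hmin.1.integrable_left).1).sub
        (integrable_inner_of_bounded hum huR hF)
    unfold energy
    rw [eintegral_congr (g₂ := fun x => ((inner ℝ (u x) (F x + D w x) - k (F x + D w x) -
        β x * ℓ (u x) - inner ℝ (u x) (F x) : ℝ) : EReal)), eintegral_coe hi]
    · refine (lt_of_le_of_lt (add_le_add_left hVle _) ?_).ne
      rw [← EReal.coe_add]
      exact EReal.coe_lt_top _
    · filter_upwards [hHβ] with x hx
      have hpos : 0 < β x := hA.pos _
      rw [extendH, if_pos hpos, ← EReal.coe_sub, hx, real_inner_comm (F x)]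
  have hgap := fun (v : Vec d → Vec d) (γ : Vec d → ℝ)
    (hv : MemUStar Λ (S : Set (LqPair d q Ω)) v γ) =>
    exists_duality_gap (ι := ι) hH hA hΩ hΛ hΛR hF hι hJ hD hmin.1 hp hG hv
  have hupper : energy f H F (S : Set (LqPair d q Ω)) u β ≤
      ((-dualValue F (volume.restrict Λ) D k ℓ w h : ℝ) : EReal) := by
    rcases hgap u β hstar with htop | ⟨g, hgi, hg, -, hen⟩
    · exact absurd htop hfin
    · have hg0 : ∫ x in Ω, g x = 0 := by
        refine integral_eq_zero_of_ae ?_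
        filter_upwards [hg, hHβ] with x hx hx'
        rw [hx.2.2.2, hx', Pi.zero_apply]
        ring
      rw [hen, hg0]
      refine (add_le_add_left hVle _).trans (le_of_eq ?_)
      rw [← EReal.coe_add]
      congr 1
      ring
  refine ⟨u, β, ⟨hstar, fun v γ hv => ?_⟩, fun v γ hv => ?_⟩
  · rcases hgap v γ hv with htop | ⟨g, hgi, hg, hlow, -⟩
    · rw [htop]
      exact le_top
    · refine hupper.trans (le_trans ?_ hlow)
      rw [EReal.coe_le_coe_iff]
      have : 0 ≤ ∫ x in Ω, g x := integral_nonneg_of_ae (hg.mono fun x hx => hx.2.2.1)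
      linarith
  · have hle := (hv.2 u β hstar).trans hupper
    rcases hgap v γ hv.1 with htop | ⟨g, hgi, hg, hlow, -⟩
    · rw [htop] at hle
      exact absurd hle (EReal.coe_lt_top _).not_ge
    · have hgn : 0 ≤ᵐ[volume.restrict Ω] g := hg.mono fun x hx => hx.2.2.1
      have h1 := hlow.trans hle
      rw [EReal.coe_le_coe_iff] at h1
      have h2 : ∫ x in Ω, g x = 0 := le_antisymm (by linarith) (integral_nonneg_of_ae hgn)
      have h3 := (integral_eq_zero_iff_of_nonneg_ae hgn hgi).1 h2
      have key : ∀ᵐ x ∂volume.restrict Ω, v x = u x ∧ γ x = β x := by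
        filter_upwards [hg, h3, hu] with x hx hx0 hux
        obtain ⟨hγ, hvG, -, hgx⟩ := hx
        rw [hx0, Pi.zero_apply] at hgx
        have a1 := hA.fenchel (-ℓ (v x)) (γ x) hγ
        have a2 := hp.le _ hvG (F x + D w x)
        have a3 : v x = u x := by
          -- Zero gap makes `v x` an exact supporting slope at a point of differentiability; the
          -- constant sequence `v x` must then converge to the gradient.
          have := (hp.tendsto hA isClosed_closure hux (y := fun _ => v x) (δ := fun _ => 0)
            (fun _ => hvG) tendsto_const_nhds fun _ => by linarith).1
          exact tendsto_nhds_unique tendsto_const_nhds this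
        -- The Fenchel slack vanishes too, so `γ x` and `β x` both maximize `s t - H t` at `s = -ℓ
        -- (v x)`.
        refine ⟨a3, hH.argmax_unique (s := -ℓ (v x)) hγ (hA.pos _) (fun t ht => ?_) fun t ht => ?_⟩
        · have := hA.fenchel (-ℓ (v x)) t ht
          linarith
        · have := hA.fenchel (-ℓ (v x)) t ht
          rw [a3] at this ⊢
          have h5 := hA.eq (-ℓ (u x))
          linarith
      exact ⟨key.mono fun x hx => hx.1, key.mono fun x hx => hx.2⟩

end Primal

/-! ### Sobolev functions and their divergence -/

section Sobolev

variable {d : ℕ}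

/-- The row-wise divergence as a continuous linear map of the derivative. -/
noncomputable def divCLM (d : ℕ) : (Vec d →L[ℝ] Mat d) →L[ℝ] Vec d :=
  LinearMap.toContinuousLinearMap
    { toFun := divOfGrad
      map_add' := fun A B => by
        ext i
        simp [divOfGrad, Finset.sum_add_distrib]
      map_smul' := fun c A => by
        ext i
        simp [divOfGrad, Finset.mul_sum] }

/-- The inclusion of `L^p` into `L^1` on a space of finite measure. -/
noncomputable def lpInclusion {α V : Type*} [MeasurableSpace α] (μ : Measure α) [IsFiniteMeasure μ]
    [NormedAddCommGroup V] [NormedSpace ℝ V] (p : ℝ≥0∞) [hp : Fact (1 ≤ p)] :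
    Lp V p μ →ₗ[ℝ] Lp V 1 μ where
  toFun g := ((Lp.memLp g).mono_exponent hp.out).toLp g
  map_add' g₁ g₂ := by
    rw [← MemLp.toLp_add]
    exact (MemLp.toLp_eq_toLp_iff _ _).2 (Lp.coeFn_add g₁ g₂)
  map_smul' c g := by
    rw [RingHom.id_apply, ← MemLp.toLp_const_smul]
    exact (MemLp.toLp_eq_toLp_iff _ _).2 (Lp.coeFn_smul c g)

theorem coeFn_lpInclusion {α V : Type*} [MeasurableSpace α] (μ : Measure α) [IsFiniteMeasure μ]
    [NormedAddCommGroup V] [NormedSpace ℝ V] (p : ℝ≥0∞) [hp : Fact (1 ≤ p)] (g : Lp V p μ) :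
    lpInclusion μ p g =ᵐ[μ] g :=
  ((Lp.memLp g).mono_exponent hp.out).coeFn_toLp

/-- The fundamental lemma of the calculus of variations, one direction at a time. Hence `φ`
determines the pair `(φ, ∇φ)`, and on `S` the norm of `φ` alone controls `div φ`. -/
theorem HasWeakGradient.ae_eq_zero {Ω : Set (Vec d)} (hΩ : IsOpen Ω) {φ : Vec d → Mat d}
    {G : Vec d → Vec d →L[ℝ] Mat d} (h : HasWeakGradient Ω φ G)
    (hφ : φ =ᵐ[volume.restrict Ω] 0) : G =ᵐ[volume.restrict Ω] 0 := by
  have hv : ∀ v : Vec d, ∀ᵐ x ∂volume.restrict Ω, G x v = 0 := fun v => by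
    rw [ae_restrict_iff' hΩ.measurableSet]
    refine hΩ.ae_eq_zero_of_integral_contDiff_smul_eq_zero (fun x hx => ?_) fun η h1 h2 h3 => ?_
    · obtain ⟨s, hs, hi⟩ := h.locallyIntegrable_grad x hx
      exact ⟨s, hs, (ContinuousLinearMap.apply ℝ (Mat d) v).integrable_comp hi⟩
    · have h4 := h.integral_eq η ⟨h1, h2, h3⟩ v
      have h5 : ∫ x in Ω, (fderiv ℝ η x v) • φ x = 0 := by
        refine integral_eq_zero_of_ae ?_
        filter_upwards [hφ] with x hx
        rw [hx, Pi.zero_apply, smul_zero]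
      rw [h5, zero_eq_neg] at h4
      rw [← h4, setIntegral_eq_integral_of_forall_compl_eq_zero]
      intro x hx
      rw [image_eq_zero_of_notMem_tsupport fun hx' => hx (h3 hx'), zero_smul]
  filter_upwards [ae_all_iff.2 fun i : Fin d => hv (EuclideanSpace.basisFun (Fin d) ℝ i)] with x hx
  refine ContinuousLinearMap.coe_injective ((EuclideanSpace.basisFun (Fin d) ℝ).toBasis.ext ?_)
  intro i
  simpa using hx i

theorem aemeasurable_divergence {q : ℝ} {Ω : Set (Vec d)} (w : LqPair d q Ω) :
    AEMeasurable (divergence w) (volume.restrict Ω) :=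
  ((divCLM d).continuous.comp_aestronglyMeasurable (Lp.aestronglyMeasurable w.2)).aemeasurable

/-- Adding a field with countable range preserves non-degeneracy. -/
theorem NonDegenerateOn.divergence_add {q : ℝ} {Ω : Set (Vec d)} {F : Vec d → Vec d}
    (hF : NonDegenerateOn Ω F) (hΩ : MeasurableSet Ω) {w : LqPair d q Ω}
    (hw : HasCountableRangeOn Ω w.2) : NonDegenerateOn Ω fun x => divergence w x + F x := by
  refine ⟨(aemeasurable_divergence w).add hF.1, fun Z hZ => ?_⟩
  obtain ⟨C, hC, hmem⟩ := hw
  rw [ae_restrict_iff' hΩ, ae_iff] at hmem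
  -- Where the gradient equals `c`, the map is `F` shifted by the constant `divOfGrad c`, and a
  -- translate of the null set `Z` is null.
  refine measure_mono_null (t := {x | ¬(x ∈ Ω → w.2 x ∈ C)} ∪
    ⋃ c ∈ C, Ω ∩ F ⁻¹' ((fun y => divOfGrad c + y) ⁻¹' Z)) ?_ ?_
  · rintro x ⟨hx, hxZ⟩
    by_cases hxC : w.2 x ∈ C
    · refine Or.inr (mem_iUnion₂.2 ⟨w.2 x, hxC, hx, ?_⟩)
      exact hxZ
    · exact Or.inl fun h => hxC (h hx)
  · refine measure_union_null hmem ((measure_biUnion_null_iff hC).2 fun c _ => hF.2 _ ?_)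
    rwa [measure_preimage_add]

/-- Finite-dimensional families of `L^p` functions `a e` and `b e` give continuous operators into
`L^1`, and the divergence of `b` is controlled by the norm of `a` if `a` is injective. -/
theorem exists_l1_operators {E : Type*} [NormedAddCommGroup E] [NormedSpace ℝ E]
    [FiniteDimensional ℝ E] {μ : Measure (Vec d)} [IsFiniteMeasure μ] {p : ℝ≥0∞} [Fact (1 ≤ p)]
    (a : E →ₗ[ℝ] Lp (Mat d) p μ) (b : E →ₗ[ℝ] Lp (Vec d →L[ℝ] Mat d) p μ)
    (ha : ∀ e, a e =ᵐ[μ] 0 → e = 0) :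
    ∃ (J : E →L[ℝ] Lp (Mat d) 1 μ) (D : E →L[ℝ] Lp (Vec d) 1 μ),
      Function.Injective J ∧ (∀ e, J e =ᵐ[μ] a e) ∧
      (∀ e, D e =ᵐ[μ] fun x => divOfGrad (b e x)) ∧ ∃ C : ℝ, 0 ≤ C ∧ ∀ e, ‖D e‖ ≤ C * ‖a e‖ := by
  obtain ⟨κ, hκ, hanti⟩ := a.exists_antilipschitzWith (LinearMap.ker_eq_bot'.2 fun e he =>
    ha e (Lp.eq_zero_iff_ae_eq_zero.1 he))
  let J : E →L[ℝ] Lp (Mat d) 1 μ := LinearMap.toContinuousLinearMap ((lpInclusion μ p).comp a)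
  let B : E →L[ℝ] Lp (Vec d →L[ℝ] Mat d) 1 μ :=
    LinearMap.toContinuousLinearMap ((lpInclusion μ p).comp b)
  let D : E →L[ℝ] Lp (Vec d) 1 μ := ((divCLM d).compLpL 1 μ).comp B
  have hJ : ∀ e, J e =ᵐ[μ] a e := fun e => coeFn_lpInclusion μ p (a e)
  have hD : ∀ e, D e =ᵐ[μ] fun x => divOfGrad (b e x) := fun e => by
    have h1 := ContinuousLinearMap.coeFn_compLpL (p := 1) (μ := μ) (divCLM d) (B e)
    have h2 : B e =ᵐ[μ] b e := coeFn_lpInclusion μ p (b e)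
    filter_upwards [h1, h2] with x hx1 hx2
    rw [hx2] at hx1
    exact hx1
  have hJinj : Function.Injective J := (injective_iff_map_eq_zero J).2 fun e he =>
    ha e ((hJ e).symm.trans (Lp.eq_zero_iff_ae_eq_zero.1 he))
  refine ⟨J, D, hJinj, hJ, hD, ‖D‖ * κ, by positivity, fun e => ?_⟩
  have h1 : ‖e‖ ≤ κ * ‖a e‖ := by simpa [dist_eq_norm] using hanti.le_mul_dist e 0
  calc ‖D e‖ ≤ ‖D‖ * ‖e‖ := D.le_opNorm e
    _ ≤ ‖D‖ * (κ * ‖a e‖) := by gcongr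
    _ = _ := by rw [mul_assoc]

end Sobolev

theorem exists_unique_minimizer {d : ℕ} (p q : ℝ) (hpq : p.HolderConjugate q)
    (Ω Λ : Set (Vec d))
    (hΩo : IsOpen Ω) (hΩn : Ω.Nonempty) (hΩb : Bornology.IsBounded Ω)
    (hΛc : Convex ℝ Λ) (r : ℝ) (hr : 1 < r)
    (hΛr : Metric.ball 0 (1 / r) ⊆ Λ) (hΛR : Λ ⊆ Metric.ball 0 (r / 2))
    (S : Submodule ℝ (LqPair d q Ω)) (hSfin : FiniteDimensional ℝ S)
    (hS : ∀ w ∈ S, MemSobolevZero w)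
    (f : Mat d → ℝ) (hf : AssumptionA1 p q f (S : Set (LqPair d q Ω)))
    (H : ℝ → ℝ) (hH : AssumptionA2 H)
    (F : Vec d → Vec d) (hF : IntegrableOn F Ω)
    (hND : ConditionND F (S : Set (LqPair d q Ω))) :
    ∃ (u : Vec d → Vec d) (β : Vec d → ℝ),
      IsMinimizer Λ f H F (S : Set (LqPair d q Ω)) u β ∧
      ∀ (v : Vec d → Vec d) (γ : Vec d → ℝ),
        IsMinimizer Λ f H F (S : Set (LqPair d q Ω)) v γ →
        v =ᵐ[volume.restrict Ω] u ∧ γ =ᵐ[volume.restrict Ω] β := by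
  have hq : Fact (1 ≤ ENNReal.ofReal q) := ⟨by
    rw [← ENNReal.ofReal_one]
    exact ENNReal.ofReal_le_ofReal hpq.symm.lt.le⟩
  have hr0 : 0 < r := one_pos.trans hr
  have : IsFiniteMeasure ((volume : Measure (Vec d)).restrict Ω) :=
    isFiniteMeasure_restrict.2 hΩb.measure_lt_top.ne
  have hΛb : Bornology.IsBounded Λ := Metric.isBounded_ball.subset hΛR
  have : IsFiniteMeasure ((volume : Measure (Vec d)).restrict Λ) :=
    isFiniteMeasure_restrict.2 hΛb.measure_lt_top.ne
  have : NeZero ((volume : Measure (Vec d)).restrict Ω) :=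
    ⟨by rw [Ne, Measure.restrict_eq_zero]; exact (hΩo.measure_pos volume hΩn).ne'⟩
  have : NeZero ((volume : Measure (Vec d)).restrict Λ) := ⟨by
    rw [Ne, Measure.restrict_eq_zero]
    exact ((Metric.measure_ball_pos volume (0 : Vec d) (by positivity)).trans_le
      (measure_mono hΛr)).ne'⟩
  have h0 : (0 : Vec d) ∈ closure Λ := subset_closure (hΛr (Metric.mem_ball_self (by positivity)))
  obtain ⟨T, A, N, hA⟩ := hH.exists_isLegendreTriple
  let R : NNReal := ⟨r / 2, by positivity⟩
  have hΛR' : ∀ y ∈ closure Λ, ‖y‖ ≤ R := fun y hy => by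
    have := closure_minimal (hΛR.trans Metric.ball_subset_closedBall) Metric.isClosed_closedBall hy
    exact (by simpa using this : ‖y‖ ≤ r / 2)
  have hΛae : ∀ᵐ y ∂(volume : Measure (Vec d)).restrict Λ, y ∈ closure Λ := by
    filter_upwards [ae_restrict_mem₀ (hΛc.nullMeasurableSet volume)] with y hy
      using subset_closure hy
  obtain ⟨a, b, c, ha, hb, hc, hgrow, -⟩ := hf.growth
  have hflow : ∀ ξ, -b ≤ f ξ := fun ξ => by
    have := (hgrow ξ).1
    have := mul_nonneg ha.le (norm_nonneg ξ)
    linarith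
  have hp0 : 0 < p := hpq.pos
  have hfup : ∀ M, ∃ C, ∀ ξ, ‖ξ‖ ≤ M → f ξ ≤ C := fun M =>
    ⟨c * M ^ p / p + b, fun ξ hξ => (hgrow ξ).2.trans (by gcongr)⟩
  have hfst : ∀ w : S, (w : LqPair d q Ω).1 =ᵐ[volume.restrict Ω] 0 → w = 0 := fun w hw => by
    have h2 := (hS w w.2).weakGradient.ae_eq_zero hΩo hw
    refine Subtype.ext (Prod.ext ?_ ?_)
    · exact (Lp.eq_zero_iff_ae_eq_zero).2 hw
    · exact (Lp.eq_zero_iff_ae_eq_zero).2 h2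
  obtain ⟨J, D, hJinj, hJ, hD, C, hC, hDC⟩ := exists_l1_operators
    ((LinearMap.fst ℝ _ _).comp S.subtype) ((LinearMap.snd ℝ _ _).comp S.subtype) hfst
  obtain ⟨k₀, ℓ₀, w, h, hfe₀, hmin₀⟩ := exists_dual_minimizer (D := D) hA hJinj hF hfup hflow
    (hΛae.mono hΛR')
  obtain ⟨G, k, ℓ, hfe, hp, hG, hℓ, hle⟩ := hfe₀.exists_conjugatePair (D := D) hA hF hΛae hΛR'
  have hmin : IsDualMinimizer H f R (volume.restrict Ω) (volume.restrict Λ) F J D k ℓ w h :=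
    ⟨hfe, fun k' ℓ' w' h' hfe' => hle.trans (hmin₀ k' ℓ' w' h' hfe')⟩
  have hdiff : ∀ᵐ x ∂volume.restrict Ω, DifferentiableAt ℝ k (F x + D w x) := by
    -- By Rademacher's theorem the Lipschitz `k` fails to be differentiable only on a null set,
    -- whose preimage under `F + div w` is null by non-degeneracy.
    have h1 := (hND w w.2).2 {v | ¬DifferentiableAt ℝ k v}
      (ae_iff.1 (hfe.lipschitz.ae_differentiableAt (μ := volume)))
    have h2 : ∀ᵐ x ∂volume.restrict Ω, DifferentiableAt ℝ k (divergence (w : LqPair d q Ω) x + F x) := by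
      rw [ae_restrict_iff' hΩo.measurableSet, ae_iff]
      refine measure_mono_null (fun x hx => ?_) h1
      simpa using hx
    filter_upwards [h2, hD w] with x hx hx'
    rwa [hx', add_comm]
  exact hmin.exists_unique_minimizer (ι := fun w : S => (w : LqPair d q Ω)) hH hA
    hΩo.measurableSet hΛb.isCompact_closure hΛR' h0 hF (fun w => w.2)
    (fun w hw => ⟨⟨w, hw⟩, rfl⟩) hJ hD hC hDC hp hG hℓ hdiff

end PseudoGradient

theorem corollary3p7 {d : ℕ} (hd : 1 ≤ d) (p q : ℝ) (hpq : p.HolderConjugate q)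
    (Ω Λ : Set (PseudoGradient.Vec d))
    (hΩo : IsOpen Ω) (hΩn : Ω.Nonempty) (hΩc : Convex ℝ Ω) (hΩb : Bornology.IsBounded Ω)
    (hΛc : Convex ℝ Λ) (r : ℝ) (hr : 1 < r)
    (hΛr : Metric.ball 0 (1 / r) ⊆ Λ) (hΛR : Λ ⊆ Metric.ball 0 (r / 2))
    (S : Submodule ℝ (PseudoGradient.LqPair d q Ω)) (hSfin : FiniteDimensional ℝ S)
    (hS : ∀ w ∈ S, PseudoGradient.MemSobolevZero w)
    (hScount : ∀ w ∈ S, PseudoGradient.HasCountableRangeOn Ω w.2)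
    (f : PseudoGradient.Mat d → ℝ)
    (hf : PseudoGradient.AssumptionA1 p q f (S : Set (PseudoGradient.LqPair d q Ω)))
    (H : ℝ → ℝ) (hH : PseudoGradient.AssumptionA2 H)
    (F : PseudoGradient.Vec d → PseudoGradient.Vec d) (hF : IntegrableOn F Ω)
    (hFnd : PseudoGradient.NonDegenerateOn Ω F) :
    PseudoGradient.ConditionND F (S : Set (PseudoGradient.LqPair d q Ω)) ∧
    ∃ (u : PseudoGradient.Vec d → PseudoGradient.Vec d) (β : PseudoGradient.Vec d → ℝ),
      PseudoGradient.IsMinimizer Λ f H F (S : Set (PseudoGradient.LqPair d q Ω)) u β ∧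
      ∀ (v : PseudoGradient.Vec d → PseudoGradient.Vec d) (γ : PseudoGradient.Vec d → ℝ),
        PseudoGradient.IsMinimizer Λ f H F (S : Set (PseudoGradient.LqPair d q Ω)) v γ →
        v =ᵐ[volume.restrict Ω] u ∧ γ =ᵐ[volume.restrict Ω] β := by
  have hND : PseudoGradient.ConditionND F (S : Set (PseudoGradient.LqPair d q Ω)) :=
    fun w hw => hFnd.divergence_add hΩo.measurableSet (hScount w hw)
  exact ⟨hND, PseudoGradient.exists_unique_minimizer p q hpq Ω Λ hΩo hΩn hΩb hΛc r hr hΛr hΛR S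
    hSfin hS f hf H hH F hF hND⟩
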